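/- A supersequence over a finite set $A$ is a finite sequence of letters of $A$ that contains every permutation of $A$ as a (not necessarily contiguous) subsequence. Let $s\ge 2$ and $n\ge 4s+1$ be integers with $n\equiv 3 \pmod{2s-1}$, and let $m=n+1$. Then over every set of $m$ letters there is a supersequence of length $$\Big\lceil m^2-\frac{5s-3}{2s-1}\,m+\frac{2s^2+9s-7}{2s-1}\Big\rceil .$$ More precisely, for a letter $x\notin\{1,\dots,n\}$, the sequence $x\,\sigma_1\,x\,\sigma_2\,x\cdots x\,\sigma_n\,x$ is a supersequence over $\{1,\dots,n\}\cup\{x\}$ of exactly this length, where $T_s(n)=(\sigma_1,\dots,\sigma_n)$ is the following list of sequences over $\{1,\dots,n\}$. Here $\sigma[i,j]$ is the substring from position $i$ to position $j$, both included, negative positions count from the end, $\sigma[-1]$ is the last letter, $\cdot$ is concatenation, $\varphi=\langle n-s+2,\dots,n\rangle$, and $\overline{\varphi}$ is the reverse of $\varphi$. 1. $\sigma_1=\langle 1,\dots,n\rangle$, $\sigma_2=\langle 1,\dots,n-1\rangle$, and $\sigma_k=\sigma_{k-2}[-1]\cdot\sigma_{k-1}[1,-2]$ for $2<k\le s+1$.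 2. For $s+1<k<n-s$: * if $k=s+2$, then $\sigma_k=\sigma_{k-2}[-1]\cdot\sigma_{k-1}[s,-s-1]\cdot\varphi\cdot\sigma_{k-1}[-s,-2]$; * if $k\equiv s+2 \pmod{2s-1}$ and $k>s+2$, then $\sigma_k=\sigma_{k-2}[-1]\cdot\sigma_{k-1}[1,s-1]\cdot\sigma_{k-1}[2s-1,-s-1]\cdot\varphi\cdot\sigma_{k-1}[-s,-2]$; * if $k\equiv 2 \pmod{2s-1}$, then $\sigma_k=\sigma_{k-2}[-1]\cdot\sigma_{k-1}[1,-s-1]$; * if $k\equiv 3 \pmod{2s-1}$, then $\sigma_k=\sigma_{k-2}[-1]\cdot\overline{\varphi}\cdot\sigma_{k-1}[1,-2]$; * otherwise $\sigma_k=\sigma_{k-2}[-1]\cdot\sigma_{k-1}[1,-2]$. 3. $\sigma_{n-s}=\sigma_{n-s-2}[-1]\cdot\sigma_{n-s-1}[1,s-1]\cdot\sigma_{n-s-1}[2s-1,-2]\cdot\overline{\varphi}$; $\sigma_k=\sigma_{k-2}[-1]\cdot\sigma_{k-1}[1,-2]$ for $n-s<k<n$; and $\sigma_n=\sigma_{n-2}[-1]\cdot\sigma_{n-1}$.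 For $s=2$ the length is Radomirović's bound $\lceil m^2-\frac73 m+\frac{19}{3}\rceil$. -/

import Mathlib

/-- `w` is a supersequence over the finite set `A`: a sequence of letters of `A` that contains
every permutation of `A` (every list of the elements of `A`, each exactly once) as a
subsequence. `List.Sublist` is the (not necessarily contiguous) subsequence relation. -/
def IsSupersequence {α : Type*} (A : Finset α) (w : List α) : Prop :=
  (∀ a ∈ w, a ∈ A) ∧ ∀ ρ : List α, ρ.Nodup → (∀ a, a ∈ ρ ↔ a ∈ A) → ρ.Sublist w

/-- The substring `σ[i, -j]`: from the `i`-th letter to the `j`-th letter from the end, both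
included (`1 ≤ i`, `1 ≤ j`). -/
def slice (σ : List ℕ) (i j : ℕ) : List ℕ := (σ.drop (i - 1)).rdrop (j - 1)

/-- The last letter `σ[-1]` (only used for nonempty `σ`). -/
def lastLetter (σ : List ℕ) : ℕ := σ.getLastD 0

/-- The sequences `T₁(n,k)`, for `1 ≤ k ≤ n`, over the letters `1, …, n`. -/
def seqT1 (n : ℕ) : ℕ → List ℕ
  | 0 => []
  | 1 => List.range' 1 n
  | 2 => List.range' 1 (n - 1)
  | k + 3 =>
    if k + 3 < n then lastLetter (seqT1 n (k + 1)) :: slice (seqT1 n (k + 2)) 1 2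
    else lastLetter (seqT1 n (k + 1)) :: seqT1 n (k + 2)

/-- The sequence `φ_s = ⟨n-s+2, …, n-1, n⟩` of the `s - 1` skip letters, in increasing order. -/
def skipLetters (s n : ℕ) : List ℕ := List.range' (n - s + 2) (s - 1)

/-- The sequences `T_s(n,k)`, for `s ≥ 2` and `1 ≤ k ≤ n`, over the letters `1, …, n`. The two
previous sequences are `σ_{k-2} = seqT s n j` and `σ_{k-1} = seqT s n (j + 1)`, with
`k = j + 2`. -/
def seqT (s n : ℕ) : ℕ → List ℕ
  | 0 => []
  | 1 => seqT1 n 1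
  | j + 2 =>
    let k := j + 2
    let a := lastLetter (seqT s n j)
    let σ := seqT s n (j + 1)
    let φ := skipLetters s n
    if k ≤ s + 1 then seqT1 n k
    else if k < n - s then
      if k ≡ s + 2 [MOD 2 * s - 1] then
        -- The skip letters jump towards the end; `(σ.rtake s).dropLast` is `σ[-s, -2]`.
        if k = s + 2 then
          [a] ++ slice σ s (s + 1) ++ φ ++ (σ.rtake s).dropLast
        else
          [a] ++ σ.take (s - 1) ++ slice σ (2 * s - 1) (s + 1) ++ φ ++ (σ.rtake s).dropLast
      else if k ≡ 2 [MOD 2 * s - 1] then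
        -- The skip letters are removed.
        [a] ++ slice σ 1 (s + 1)
      else if k ≡ 3 [MOD 2 * s - 1] then
        -- The skip letters return, in reverse order.
        [a] ++ φ.reverse ++ slice σ 1 2
      else
        -- All remaining residues.
        [a] ++ slice σ 1 2
    else if k = n - s then
      [a] ++ σ.take (s - 1) ++ slice σ (2 * s - 1) 2 ++ φ.reverse
    else if k < n then [a] ++ slice σ 1 2
    else [a] ++ σ

/-- The list of sequences `T_s(n) = (T_s(n,1), …, T_s(n,n))`. -/
def listT (s n : ℕ) : List (List ℕ) := (List.range n).map (fun i => seqT s n (i + 1))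

/-- Interposing a letter: `interpose x [σ₁, …, σₙ] = x σ₁ x σ₂ x … x σₙ x`. -/
def interpose {α : Type*} (x : α) (L : List (List α)) : List α :=
  x :: L.flatMap (fun σ => σ ++ [x])

/-!
The letters `1, …, n` split into the `r = s - 1` *skip letters* `N + 1, …, n` and the `N = n - r`
*normal letters* `1, …, N`. The whole proof is parametrised by `r` and `N`, and the congruence
condition on `n` reads `N + r = 3 + (2 * r + 1) * Q`.

*Closed forms.* Write `cyc N c` for the cyclic word `c+1, …, N, 1, …, c-1` on the normal letters
other than `c`. For `s < k ≤ n - s` the normal letters of `σ_k` form `cyc N (n + 2 - k)`, so that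
the normal letter missing from `σ_k` is the last letter of `σ_{k-1}`. For `s + 1 < k < n - s` the
skip letters are inserted into this word as a contiguous increasing or decreasing run, at a place
that depends only on the residue of `k` modulo `2 * s - 1`, or are absent (`seqT_mid`). The first
`s + 1` and the last `s + 1` sequences are given by `seqT_start`, `seqT_penult`, `seqT_end` and
`seqT_last`.

*Prefixes.* Every list `α` of `k` distinct letters is a subsequence of `σ_1 σ_2 ⋯ σ_k`
(`sublist_prefixCat`). A greedy embedding can fail only when the next letter is a skip letter and
the next sequence has none, so the induction carries a reserve. Let `U` be the number of skip
letters that do not occur in `α`. Then `α` is a subsequence of `σ_1 ⋯ σ_{k-1} X`, where `X` is `σ_k`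
cut just before its `U`-th last normal letter; if at most `U` normal letters follow the run of skip
letters, then the run is cut off as well (`cutAt`). When a normal letter `a` is appended, then
either `a` lies in the uncut part of `σ_{k+1}`, or `a` is one of the last `U + 1` normal letters of
`σ_k`; in the latter case it comes after `X` or is its last letter, and since `a` does not occur in
`α` it can be placed in `σ_k`. When a skip letter is appended, `U` drops by one, and the skip letter
is placed in `σ_k` if its run was cut off there and in `σ_{k+1}` otherwise (`embed_step`). Among the
first `s + 1` sequences the same works with the last `U` letters of `σ_k` cut, whatever they are,
except that nothing is cut while `α` consists of skip letters only (`embed_start`). In the last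
`s + 1` sequences the reserve is no longer needed (`seqT_end_cases`).

*Suffixes.* The involution `a ↦ s + 2 - a (mod N)` of the normal letters, extended by the identity
to the skip letters, carries the reverse of `σ_k` to `σ_{n+1-k}` (`mirror_seqT`); this symmetry
rests on `n ≡ 3 (mod 2s - 1)`. Hence every list of `n - k` distinct letters is a subsequence of
`σ_{k+1} ⋯ σ_n` (`sublist_drop_listT`). A permutation `α x β` with `α` of length `k` then embeds
into `x σ_1 x ⋯ σ_k x` followed by `σ_{k+1} x ⋯ σ_n x`.

*Length.* The sequences have length `n - 1`, except that `σ_1` and `σ_n` have length `n`, and that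
the `Q - 1` sequences without skip letters have length `N - 1`. The total `n ^ 2 + 3 - r * (Q - 1)`
is exactly the real number under the ceiling.
-/

/-! ### Words with an inserted block -/

/-- The cyclic word `c + 1, …, N, 1, …, c - 1` on the normal letters other than `c`
(for `1 ≤ c ≤ N`). -/
def cyc (N c : ℕ) : List ℕ := List.range' (c + 1) (N - c) ++ List.range' 1 (c - 1)

/-- The word `W` with the word `ψ` inserted after its first `p` letters. -/
def insertAt (W ψ : List ℕ) (p : ℕ) : List ℕ := W.take p ++ ψ ++ W.drop p

theorem length_cyc {N c : ℕ} (h1 : 1 ≤ c) (h2 : c ≤ N) : (cyc N c).length = N - 1 := by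
  simp [cyc]; omega

theorem mem_cyc {N c a : ℕ} (h1 : 1 ≤ c) (h2 : c ≤ N) :
    a ∈ cyc N c ↔ 1 ≤ a ∧ a ≤ N ∧ a ≠ c := by
  simp [cyc, List.mem_range'_1]; omega

theorem dropLast_range' (a n : ℕ) : (List.range' a n).dropLast = List.range' a (n - 1) := by
  cases n with
  | zero => rfl
  | succ n => rw [List.range'_concat]; simp

/-- The step from `σ_{k-1}` to `σ_k` on the normal letters: the last letter is dropped, and the
letter that was missing is put in front. -/
theorem cyc_eq_cons {N c : ℕ} (h1 : 1 ≤ c) (h2 : c < N) :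
    cyc N c = (c + 1) :: (cyc N (c + 1)).dropLast := by
  have : N - c = (N - (c + 1)) + 1 := by omega
  rw [cyc, cyc, this, List.range'_succ, List.dropLast_append_of_ne_nil, dropLast_range']
  · simp
  · simp; omega

theorem cyc_eq_concat {N c : ℕ} (h1 : 2 ≤ c) :
    cyc N c = List.range' (c + 1) (N - c) ++ List.range' 1 (c - 2) ++ [c - 1] := by
  have : c - 1 = (c - 2) + 1 := by omega
  rw [cyc, this, List.range'_concat]; simp; omega

theorem lastLetter_append {l₁ l₂ : List ℕ} (h : l₂ ≠ []) :
    lastLetter (l₁ ++ l₂) = lastLetter l₂ := by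
  simp only [lastLetter, List.getLastD_eq_getLast?]
  rw [List.getLast?_append_of_ne_nil _ h]

theorem lastLetter_concat (l : List ℕ) (a : ℕ) : lastLetter (l ++ [a]) = a := by
  simp [lastLetter]

theorem lastLetter_cyc {N c : ℕ} (h1 : 2 ≤ c) : lastLetter (cyc N c) = c - 1 := by
  rw [cyc_eq_concat h1, lastLetter_concat]

theorem lastLetter_drop {l : List ℕ} {p : ℕ} (h : p < l.length) :
    lastLetter (l.drop p) = lastLetter l := by
  conv_rhs => rw [← List.take_append_drop p l]
  rw [lastLetter_append]
  simpa using h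

theorem lastLetter_insertAt {W ψ : List ℕ} {p : ℕ} (h : p < W.length) :
    lastLetter (insertAt W ψ p) = lastLetter W := by
  rw [insertAt, lastLetter_append, lastLetter_drop h]
  simpa using h

theorem slice_one_two (l : List ℕ) : slice l 1 2 = l.dropLast := by
  simp [slice, List.rdrop, List.dropLast_eq_take]

theorem insertAt_cons_dropLast {W ψ : List ℕ} {p e : ℕ} (h : p < W.length) :
    insertAt (e :: W.dropLast) ψ (p + 1) = e :: (insertAt W ψ p).dropLast := by
  have h2 : W.drop p ≠ [] := by simpa using h
  rw [insertAt, insertAt, List.dropLast_append_of_ne_nil h2]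
  have h3 : min p (W.length - 1) = p := by omega
  have h4 : W.length - 1 - p = W.length - p - 1 := by omega
  simp only [List.take_succ_cons, List.drop_succ_cons, List.cons_append, List.append_assoc,
    List.dropLast_eq_take, List.take_take, List.length_drop, List.drop_take, h3, h4]

/-! ### Closed forms of the sequences -/

theorem seqT1_eq (n k : ℕ) (h1 : 1 ≤ k) (h2 : k < n) :
    seqT1 n k = List.range' (n + 3 - k) (k - 2) ++ List.range' 1 (n + 1 - k) := by
  induction k using Nat.strong_induction_on with
  | _ k ih =>
    match k, h1 with
    | 1, _ => simp [seqT1]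
    | 2, _ => simp [seqT1]
    | k + 3, _ =>
      have e1 : n + 1 - (k + 1) = n - (k + 1) + 1 := by omega
      have e2 : n + 1 - (k + 2) = n - (k + 2) + 1 := by omega
      rw [seqT1, if_pos h2, ih (k + 1) (by omega) (by omega) (by omega),
        ih (k + 2) (by omega) (by omega) (by omega), slice_one_two, e1, e2, List.range'_concat,
        List.range'_concat, ← List.append_assoc, ← List.append_assoc, lastLetter_concat,
        List.dropLast_concat, ← List.cons_append]
      congr 1
      · rw [show k + 3 - 2 = (k + 2 - 2) + 1 by omega, List.range'_succ]
        congr 1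
        · omega
        · congr 1; omega
      · congr 1; omega

/-- The run of skip letters in the `k`-th sequence, where `t` is the residue of `k - (s + 2)` modulo
`2 * s - 1 = 2 * r + 1`: increasing after the jump towards the end, absent for `t = r`, and
decreasing after the return. -/
def skipWord (r N t : ℕ) : List ℕ :=
  if t < r then List.range' (N + 1) r else if t = r then [] else (List.range' (N + 1) r).reverse

/-- The number of normal letters in front of the run of skip letters. For `t < r` exactly `r - t`
normal letters come after the run, and for `t > r` exactly `t - r` come before it. For `t = r` the
run is empty and its place at the end is a convention: then no normal letter follows it. -/
def skipPos (r N t : ℕ) : ℕ := if t ≤ r then N - 1 - (r - t) else t - r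

theorem skipLetters_succ {r N : ℕ} (hN : 1 ≤ N) :
    skipLetters (r + 1) (N + r) = List.range' (N + 1) r := by
  rw [skipLetters, Nat.add_sub_cancel, show N + r - (r + 1) + 2 = N + 1 by omega]

section
variable {W ψ : List ℕ} {p r : ℕ}

theorem take_insertAt (hp : p ≤ W.length) : (insertAt W ψ p).take p = W.take p := by
  rw [insertAt, List.append_assoc, List.take_left']; simp [hp]

theorem drop_insertAt (hp : p ≤ W.length) :
    (insertAt W ψ p).drop (p + ψ.length) = W.drop p := by
  rw [insertAt, List.drop_left']; simp [hp]

theorem length_insertAt : (insertAt W ψ p).length = W.length + ψ.length := by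
  simp only [insertAt, List.length_append, List.length_take, List.length_drop]; omega

theorem drop_insertAt_length_sub {d : ℕ} (hp : p + d ≤ W.length) :
    (insertAt W ψ p).drop (W.length + ψ.length - d) = W.drop (W.length - d) := by
  rw [show W.length + ψ.length - d = (p + ψ.length) + (W.length - d - p) by omega,
    ← List.drop_drop, drop_insertAt (by omega), List.drop_drop]
  congr 1; omega

/-- The recursion when the skip letters jump towards the end. It serves both rules of that kind:
`p = 0` for the first jump, `p = r` for the later ones. -/
theorem cons_jump (e : ℕ) (φ : List ℕ) (hψ : ψ.length = r) (hp : p ≤ r)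
    (hW : 2 * r + 1 ≤ W.length) :
    [e] ++ ((insertAt W ψ p).take p ++ slice (insertAt W ψ p) (p + r + 1) (r + 2)) ++ φ
      ++ ((insertAt W ψ p).rtake (r + 1)).dropLast
    = insertAt (e :: W.dropLast) φ (W.length - r) := by
  have h1 : slice (insertAt W ψ p) (p + r + 1) (r + 2)
      = (W.drop p).take (W.length - r - 1 - p) := by
    rw [slice, List.rdrop, Nat.add_sub_cancel, ← hψ, drop_insertAt (by omega)]
    simp only [List.length_drop]
    congr 1; omega
  have h2 : (insertAt W ψ p).rtake (r + 1) = W.drop (W.length - r - 1) := by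
    rw [List.rtake, length_insertAt, drop_insertAt_length_sub (by omega)]; rfl
  have h3 : p + (W.length - r - 1 - p) = W.length - r - 1 := by omega
  rw [h1, h2, take_insertAt (by omega), ← List.take_add, h3,
    show W.length - r = W.length - r - 1 + 1 by omega,
    insertAt_cons_dropLast (by omega), insertAt, List.dropLast_append_of_ne_nil]
  · simp
  · simp; omega

/-- The recursion when the skip letters are removed, the run being followed by a single letter. -/
theorem cons_remove (e : ℕ) (hψ : ψ.length = r) (hW : 1 ≤ W.length) :
    [e] ++ slice (insertAt W ψ (W.length - 1)) 1 (r + 2) = e :: W.dropLast := by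
  have h1 : (insertAt W ψ (W.length - 1)).length - (r + 2 - 1) = W.length - 1 := by
    rw [length_insertAt]; omega
  rw [slice, List.rdrop, Nat.sub_self, List.drop_zero, h1, take_insertAt (by omega),
    List.dropLast_eq_take, List.singleton_append]

/-- The recursion for `σ_{n-s}`, where the skip letters move to the very end. -/
theorem cons_final (e : ℕ) (φ : List ℕ) (hψ : ψ.length = r) (hW : r + 1 ≤ W.length) :
    [e] ++ (insertAt W ψ r).take r ++ slice (insertAt W ψ r) (2 * r + 1) 2 ++ φ
      = (e :: W.dropLast) ++ φ := by
  have h1 : slice (insertAt W ψ r) (2 * r + 1) 2 = (W.drop r).take (W.length - 1 - r) := by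
    rw [slice, List.rdrop, Nat.add_sub_cancel, show 2 * r = r + ψ.length by omega,
      drop_insertAt (by omega)]
    simp only [List.length_drop]
    congr 1; omega
  have h3 : r + (W.length - 1 - r) = W.length - 1 := by omega
  rw [h1, take_insertAt (by omega), List.append_assoc [e], ← List.take_add, h3,
    List.dropLast_eq_take, List.singleton_append]
end

theorem modEq_iff {r j i : ℕ} (hi : i < 2 * r + 1) :
    r + 3 + j ≡ r + 3 + i [MOD 2 * (r + 1) - 1] ↔ j % (2 * r + 1) = i := by
  rw [show 2 * (r + 1) - 1 = 2 * r + 1 by omega]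
  constructor
  · intro h
    have := Nat.ModEq.add_left_cancel' _ h
    rw [Nat.ModEq, Nat.mod_eq_of_lt hi] at this
    exact this
  · intro h
    refine Nat.ModEq.add_left _ ?_
    rw [Nat.ModEq, Nat.mod_eq_of_lt hi, h]

theorem modEq_two_iff {r j : ℕ} :
    r + 3 + j ≡ 2 [MOD 2 * (r + 1) - 1] ↔ j % (2 * r + 1) = r := by
  rw [← modEq_iff (by omega)]
  have : r + 3 + r ≡ 2 [MOD 2 * (r + 1) - 1] := by
    rw [show 2 * (r + 1) - 1 = 2 * r + 1 by omega, show r + 3 + r = 2 + (2 * r + 1) by omega]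
    simp [Nat.ModEq]
  exact ⟨fun h => h.trans this.symm, fun h => h.trans this⟩

theorem modEq_three_iff {r j : ℕ} (hr : 1 ≤ r) :
    r + 3 + j ≡ 3 [MOD 2 * (r + 1) - 1] ↔ j % (2 * r + 1) = r + 1 := by
  rw [← modEq_iff (by omega)]
  have : r + 3 + (r + 1) ≡ 3 [MOD 2 * (r + 1) - 1] := by
    rw [show 2 * (r + 1) - 1 = 2 * r + 1 by omega,
      show r + 3 + (r + 1) = 3 + (2 * r + 1) by omega]
    simp [Nat.ModEq]
  exact ⟨fun h => h.trans this.symm, fun h => h.trans this⟩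

theorem seqT_start {r N k : ℕ} (hN : 3 ≤ N) (h1 : 1 ≤ k) (h2 : k ≤ r + 2) :
    seqT (r + 1) (N + r) k
      = List.range' (N + r + 3 - k) (k - 2) ++ List.range' 1 (N + r + 1 - k) := by
  rw [← seqT1_eq _ _ h1 (by omega)]
  match k, h1 with
  | 1, _ => rfl
  | k + 2, _ => rw [seqT]; simp [h2]

theorem lastLetter_seqT_start {r N k : ℕ} (hN : 3 ≤ N) (h1 : 1 ≤ k) (h2 : k ≤ r + 2) :
    lastLetter (seqT (r + 1) (N + r) k) = N + r + 1 - k := by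
  rw [seqT_start hN h1 h2, show N + r + 1 - k = N + r - k + 1 by omega, List.range'_concat,
    ← List.append_assoc, lastLetter_concat]
  omega

/-- The closed form of the `k`-th sequence for `k = s + 2 + j = r + 3 + j < n - s`. -/
def midBlock (r N j : ℕ) : List ℕ :=
  insertAt (cyc N (N - 1 - j)) (skipWord r N (j % (2 * r + 1))) (skipPos r N (j % (2 * r + 1)))

theorem lastLetter_midBlock {r N j : ℕ} (hr : 1 ≤ r) (hN : 3 * r + 5 ≤ N) (hj : r + 5 + j ≤ N) :
    lastLetter (midBlock r N j) = N - 2 - j := by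
  have ht := Nat.mod_lt j (show 2 * r + 1 > 0 by omega)
  have hl := length_cyc (N := N) (c := N - 1 - j) (by omega) (by omega)
  have hL := lastLetter_cyc (N := N) (c := N - 1 - j) (by omega)
  rw [midBlock]
  generalize j % (2 * r + 1) = t at ht
  by_cases h : t = r
  · subst h
    rw [skipPos, skipWord, if_pos le_rfl, if_neg (lt_irrefl _), if_pos rfl, insertAt,
      Nat.sub_self, Nat.sub_zero, List.append_nil, List.take_append_drop, hL]
    omega
  · rw [lastLetter_insertAt, hL]
    · omega
    · rw [hl, skipPos]; split_ifs <;> omega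

theorem succ_mod_eq (r j : ℕ) (hr : 1 ≤ r) : (j + 1) % (2 * r + 1) =
    if j % (2 * r + 1) = 2 * r then 0 else j % (2 * r + 1) + 1 := by
  rw [Nat.add_mod_eq_ite, Nat.mod_eq_of_lt (show 1 < 2 * r + 1 by omega)]
  have := Nat.mod_lt j (show 2 * r + 1 > 0 by omega)
  split_ifs <;> omega

theorem seqT_mid_of_prev {r N j : ℕ} (hr : 1 ≤ r) (hN : 3 * r + 5 ≤ N) (hj : r + 5 + j + 1 ≤ N)
    (h1 : seqT (r + 1) (N + r) (r + 3 + j) = midBlock r N j)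
    (h2 : lastLetter (seqT (r + 1) (N + r) (r + 2 + j)) = N - 1 - j) :
    seqT (r + 1) (N + r) (r + 3 + (j + 1)) = midBlock r N (j + 1) := by
  have hq : 0 < 2 * r + 1 := by omega
  have hmod := succ_mod_eq r j hr
  have ht := Nat.mod_lt j hq
  rw [show r + 3 + (j + 1) = (r + 2 + j) + 2 by omega, seqT,
    show r + 2 + j + 1 = r + 3 + j by omega, h1, h2, skipLetters_succ (by omega)]
  simp only [show r + 2 + j + 2 = r + 3 + (j + 1) by omega]
  rw [if_neg (by omega), if_pos (by omega)]
  have m1 : r + 3 + (j + 1) ≡ r + 1 + 2 [MOD 2 * (r + 1) - 1] ↔ (j + 1) % (2 * r + 1) = 0 :=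
    modEq_iff (i := 0) (by omega)
  have hl := length_cyc (N := N) (c := N - 1 - j) (by omega) (by omega)
  have hc := cyc_eq_cons (N := N) (c := N - 1 - (j + 1)) (by omega) (by omega)
  rw [show N - 1 - (j + 1) + 1 = N - 1 - j by omega] at hc
  simp only [m1, modEq_two_iff, modEq_three_iff hr]
  rw [if_neg (show ¬ (r + 3 + (j + 1) = r + 1 + 2) by omega)]
  simp only [slice_one_two]
  simp only [midBlock, hmod, hc]
  generalize j % (2 * r + 1) = t at ht
  generalize cyc N (N - 1 - j) = W at *
  generalize N - 1 - j = e
  have key : ∀ ψ p, p < W.length →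
      [e] ++ (insertAt W ψ p).dropLast = insertAt (e :: W.dropLast) ψ (p + 1) :=
    fun ψ p h => by rw [insertAt_cons_dropLast h]; rfl
  by_cases h0 : t = 2 * r
  · subst h0
    simp only [if_true]
    have e1 : skipWord r N (2 * r) = (List.range' (N + 1) r).reverse := by
      rw [skipWord, if_neg (by omega), if_neg (by omega)]
    have e2 : skipPos r N (2 * r) = r := by rw [skipPos, if_neg (by omega)]; omega
    have e3 : skipWord r N 0 = List.range' (N + 1) r := by rw [skipWord, if_pos (by omega)]
    have e4 : skipPos r N 0 = W.length - r := by rw [skipPos, if_pos (by omega), hl]; omega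
    rw [e1, e2, e3, e4, ← cons_jump (p := r) (ψ := (List.range' (N + 1) r).reverse)
      e _ (by simp) le_rfl (by omega)]
    simp only [List.append_assoc, Nat.add_sub_cancel]
    congr 4; omega
  · simp only [h0, if_false]
    rw [if_neg (by omega)]
    by_cases h1 : t + 1 = r
    · rw [if_pos h1]
      have e1 : skipWord r N t = List.range' (N + 1) r := by rw [skipWord, if_pos (by omega)]
      have e2 : skipPos r N t = W.length - 1 := by rw [skipPos, if_pos (by omega)]; omega
      have e3 : skipWord r N (t + 1) = [] := by
        rw [skipWord, if_neg (by omega), if_pos (by omega)]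
      rw [e1, e2, e3, cons_remove e (by simp) (by omega)]
      simp [insertAt]
    · rw [if_neg h1]
      by_cases h2 : t = r
      · subst h2
        rw [if_pos rfl]
        have e1 : skipWord t N t = [] := by simp [skipWord]
        have e2 : skipPos t N t = N - 1 := by simp [skipPos]
        have e3 : skipWord t N (t + 1) = (List.range' (N + 1) t).reverse := by
          rw [skipWord, if_neg (by omega), if_neg (by omega)]
        have e4 : skipPos t N (t + 1) = 1 := by rw [skipPos, if_neg (by omega)]; omega
        rw [e1, e2, e3, e4]
        simp [insertAt]
      · rw [if_neg (by omega), key]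
        · congr 1
          · simp only [skipWord]; split_ifs <;> first | rfl | omega
          · simp only [skipPos]; split_ifs <;> omega
        · rw [hl]; simp only [skipPos]; split_ifs <;> omega

theorem seqT_mid_zero {r N : ℕ} (hr : 1 ≤ r) (hN : 3 * r + 5 ≤ N) :
    seqT (r + 1) (N + r) (r + 3) = midBlock r N 0 := by
  have hc := cyc_eq_cons (N := N) (c := N - 1) (by omega) (by omega)
  rw [show N - 1 + 1 = N by omega] at hc
  have hl := length_cyc (N := N) (c := N) (by omega) (by omega)
  have h1 : seqT (r + 1) (N + r) (r + 2) = insertAt (cyc N N) (List.range' (N + 1) r) 0 := by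
    rw [seqT_start (by omega) (by omega) le_rfl]
    simp only [insertAt, cyc, List.take_zero, List.drop_zero, Nat.sub_self, List.range'_zero,
      List.nil_append]
    congr 2 <;> omega
  rw [seqT, h1, lastLetter_seqT_start (by omega) (by omega) (by omega), skipLetters_succ (by omega)]
  simp only
  rw [if_neg (by omega), if_pos (by omega), if_pos (Nat.ModEq.refl _), if_pos trivial, midBlock,
    Nat.zero_mod]
  have e3 : skipWord r N 0 = List.range' (N + 1) r := by rw [skipWord, if_pos (by omega)]
  have e4 : skipPos r N 0 = (cyc N N).length - r := by rw [skipPos, if_pos (by omega), hl]; omega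
  rw [e3, e4, Nat.sub_zero, hc, ← cons_jump (p := 0) (ψ := List.range' (N + 1) r)
      _ _ (by simp) (by omega) (by omega)]
  simp only [List.take_zero, List.nil_append, Nat.zero_add]
  congr 4; omega

theorem seqT_mid {r N j : ℕ} (hr : 1 ≤ r) (hN : 3 * r + 5 ≤ N) (hj : r + 5 + j ≤ N) :
    seqT (r + 1) (N + r) (r + 3 + j) = midBlock r N j := by
  induction j using Nat.strong_induction_on with
  | _ j ih =>
    match j with
    | 0 => exact seqT_mid_zero hr hN
    | 1 =>
      refine seqT_mid_of_prev hr hN (by omega) (ih 0 (by omega) (by omega)) ?_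
      rw [lastLetter_seqT_start (by omega) (by omega) (by omega)]; omega
    | j + 2 =>
      refine seqT_mid_of_prev hr hN (by omega) (ih (j + 1) (by omega) (by omega)) ?_
      rw [show r + 2 + (j + 1) = r + 3 + j by omega, ih j (by omega) (by omega),
        lastLetter_midBlock hr hN (by omega)]
      omega

theorem seqT_penult {r N Q : ℕ} (hr : 1 ≤ r) (hN : 3 * r + 5 ≤ N)
    (hQ : N + r = 3 + (2 * r + 1) * Q) :
    seqT (r + 1) (N + r) (N - 1) = cyc N (r + 3) ++ (List.range' (N + 1) r).reverse := by
  obtain ⟨j, rfl⟩ : ∃ j, N = r + 5 + j := ⟨N - (r + 5), by omega⟩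
  have hj : j % (2 * r + 1) = 2 * r := by
    have h : j + 1 = (2 * r + 1) * (Q - 1) := by
      rw [Nat.mul_sub]; omega
    have h' : (j + 1) % (2 * r + 1) = 0 := by rw [h]; simp
    rw [succ_mod_eq r j hr] at h'
    split_ifs at h' with h''
    exact h''
  have h1 := seqT_mid hr hN (j := j) (by omega)
  have h2 : lastLetter (seqT (r + 1) (r + 5 + j + r) (r + 2 + j)) = r + 4 := by
    match j with
    | 0 => rw [lastLetter_seqT_start (by omega) (by omega) (by omega)]; omega
    | j + 1 =>
      rw [show r + 2 + (j + 1) = r + 3 + j by omega, seqT_mid hr hN (by omega),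
        lastLetter_midBlock hr hN (by omega)]
      omega
  have hl := length_cyc (N := r + 5 + j) (c := r + 4) (by omega) (by omega)
  rw [show r + 5 + j - 1 = (r + 2 + j) + 2 by omega, seqT,
    show r + 2 + j + 1 = r + 3 + j by omega, h1, h2, skipLetters_succ (by omega)]
  rw [if_neg (by omega), if_neg (by omega), if_pos (by omega), midBlock, hj]
  have e1 : skipWord r (r + 5 + j) (2 * r) = (List.range' (r + 5 + j + 1) r).reverse := by
    rw [skipWord, if_neg (by omega), if_neg (by omega)]
  have e2 : skipPos r (r + 5 + j) (2 * r) = r := by rw [skipPos, if_neg (by omega)]; omega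
  rw [e1, e2, show r + 5 + j - 1 - j = r + 4 by omega,
    show 2 * (r + 1) - 1 = 2 * r + 1 by omega, Nat.add_sub_cancel,
    cons_final _ _ (by simp) (by omega), ← cyc_eq_cons (by omega) (by omega)]

/-- All normal letters in the cyclic order in which they occur in the last `s` sequences. -/
def lastWord (r N : ℕ) : List ℕ := List.range' (r + 3) (N - r - 2) ++ List.range' 1 (r + 2)

theorem lastLetter_append_reverse_range' (l : List ℕ) (a : ℕ) {n : ℕ} (h : 1 ≤ n) :
    lastLetter (l ++ (List.range' a n).reverse) = a := by
  obtain ⟨n, rfl⟩ : ∃ m, n = m + 1 := ⟨n - 1, by omega⟩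
  rw [List.range'_succ, List.reverse_cons, ← List.append_assoc, lastLetter_concat]

theorem dropLast_append_reverse_range' (l : List ℕ) (a : ℕ) {n : ℕ} (h : 1 ≤ n) :
    (l ++ (List.range' a n).reverse).dropLast = l ++ (List.range' (a + 1) (n - 1)).reverse := by
  obtain ⟨n, rfl⟩ : ∃ m, n = m + 1 := ⟨n - 1, by omega⟩
  rw [List.range'_succ, List.reverse_cons, ← List.append_assoc, List.dropLast_concat,
    Nat.add_sub_cancel]

section
variable {r N Q : ℕ}

theorem seqT_end_succ_of_prev {i : ℕ} (hN : 3 * r + 5 ≤ N) (hi : i + 1 ≤ r)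
    {l : List ℕ}
    (h1 : seqT (r + 1) (N + r) (N - 1 + i) = l ++ (List.range' (N + 1 + i) (r - i)).reverse) :
    seqT (r + 1) (N + r) (N - 1 + (i + 1)) =
      lastLetter (seqT (r + 1) (N + r) (N - 2 + i)) ::
        (l ++ (List.range' (N + 1 + (i + 1)) (r - (i + 1))).reverse) := by
  rw [show N - 1 + (i + 1) = (N - 2 + i) + 2 by omega, seqT,
    show N - 2 + i + 1 = N - 1 + i by omega, h1]
  rw [if_neg (by omega), if_neg (by omega), if_neg (by omega), if_pos (by omega), slice_one_two,
    dropLast_append_reverse_range' _ _ (by omega)]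
  rfl

theorem seqT_end (hr : 1 ≤ r) (hN : 3 * r + 5 ≤ N) (hQ : N + r = 3 + (2 * r + 1) * Q) {i : ℕ}
    (hi : i + 1 ≤ r) : seqT (r + 1) (N + r) (N + i) =
      (List.range' (N + 1) i).reverse ++ lastWord r N
        ++ (List.range' (N + 2 + i) (r - 1 - i)).reverse := by
  induction i using Nat.strong_induction_on with
  | _ i ih =>
    match i with
    | 0 =>
      have h := seqT_end_succ_of_prev (i := 0) hN (by omega) (seqT_penult hr hN hQ)
      obtain ⟨j, rfl⟩ : ∃ j, N = r + 5 + j := ⟨N - (r + 5), by omega⟩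
      have h2 : lastLetter (seqT (r + 1) (r + 5 + j + r) (r + 5 + j - 2 + 0)) = r + 3 := by
        rw [show r + 5 + j - 2 + 0 = r + 3 + j by omega, seqT_mid hr hN (by omega),
          lastLetter_midBlock hr hN (by omega)]
        omega
      rw [show r + 5 + j + 0 = r + 5 + j - 1 + (0 + 1) by omega, h, h2, lastWord,
        show r + 5 + j - r - 2 = r + 5 + j - (r + 3) + 1 by omega, List.range'_succ, cyc]
      simp only [List.range'_zero, List.reverse_nil, List.nil_append, List.cons_append]
      rfl
    | i + 1 =>
      have h1 := ih i (by omega) (by omega)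
      have h := seqT_end_succ_of_prev (i := i + 1) (l := (List.range' (N + 1) i).reverse
        ++ lastWord r N) hN hi (by
          rw [show N - 1 + (i + 1) = N + i by omega, h1]
          congr 3 <;> omega)
      have h2 : lastLetter (seqT (r + 1) (N + r) (N - 2 + (i + 1))) = N + 1 + i := by
        match i with
        | 0 =>
          rw [show N - 2 + (0 + 1) = N - 1 by omega, seqT_penult hr hN hQ,
            lastLetter_append_reverse_range' _ _ hr]
        | i + 1 =>
          rw [show N - 2 + (i + 1 + 1) = N + i by omega, ih i (by omega) (by omega),
            lastLetter_append_reverse_range' _ _ (by omega)]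
          omega
      rw [show N + (i + 1) = N - 1 + (i + 1 + 1) by omega, h, h2, List.range'_concat,
        List.reverse_append]
      simp only [List.reverse_singleton, List.cons_append, Nat.one_mul]
      congr 4 <;> omega

theorem seqT_last (hr : 1 ≤ r) (hN : 3 * r + 5 ≤ N) (hQ : N + r = 3 + (2 * r + 1) * Q) :
    seqT (r + 1) (N + r) (N + r) = (List.range' (N + 1) r).reverse ++ lastWord r N := by
  have h1 := seqT_end hr hN hQ (i := r - 1) (by omega)
  have h2 : lastLetter (seqT (r + 1) (N + r) (N + r - 2)) = N + r := by
    match r, hr with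
    | 1, _ =>
      rw [show N + 1 - 2 = N - 1 by omega, seqT_penult le_rfl hN hQ,
        lastLetter_append_reverse_range' _ _ le_rfl]
    | r + 2, _ =>
      rw [show N + (r + 2) - 2 = N + r by omega, seqT_end (by omega) hN hQ (by omega),
        lastLetter_append_reverse_range' _ _ (by omega)]
      omega
  obtain ⟨k, hk⟩ : ∃ k, N + r = k + 2 := ⟨N + r - 2, by omega⟩
  have h3 : seqT (r + 1) (N + r) (k + 2) = lastLetter (seqT (r + 1) (N + r) k) ::
      seqT (r + 1) (N + r) (k + 1) := by
    conv_lhs => rw [seqT]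
    rw [if_neg (by omega), if_neg (by omega), if_neg (by omega), if_neg (by omega)]
    rfl
  conv_lhs => rw [show seqT (r + 1) (N + r) (N + r) = seqT (r + 1) (N + r) (k + 2) from
    congrArg _ hk, h3, show k = N + r - 2 by omega, h2,
    show N + r - 2 + 1 = N + (r - 1) by omega, h1]
  obtain ⟨r, rfl⟩ : ∃ t, r = t + 1 := ⟨r - 1, by omega⟩
  rw [Nat.add_sub_cancel, Nat.sub_self, List.range'_concat, List.reverse_append]
  simp; omega
end

/-! ### Greedy embedding with a reserve -/

/-- The concatenation `σ_1 ⋯ σ_k` of the sequences `T_s(n,1), …, T_s(n,k)`. -/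
def prefixCat (s n k : ℕ) : List ℕ := ((List.range k).map fun i => seqT s n (i + 1)).flatten

theorem prefixCat_succ (s n k : ℕ) :
    prefixCat s n (k + 1) = prefixCat s n k ++ seqT s n (k + 1) := by
  simp [prefixCat, List.range_succ]

/-- `α` is a list of distinct letters from `{1, …, n}`. -/
def IsPartialPerm (n : ℕ) (α : List ℕ) : Prop := α.Nodup ∧ ∀ a ∈ α, 1 ≤ a ∧ a ≤ n

/-- The number of skip letters `N + 1, …, N + r` that do not occur in `α`, for `α` without
repetitions and with letters in `{1, …, N + r}`. -/
def skipsLeft (r N : ℕ) (α : List ℕ) : ℕ := r - α.countP (N < ·)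

theorem sublist_concat_of_not_mem {L α : List ℕ} {a : ℕ} (h : List.Sublist α (L ++ [a]))
    (ha : a ∉ α) : List.Sublist (α ++ [a]) (L ++ [a]) := by
  refine List.Sublist.append ?_ (List.Sublist.refl _)
  obtain ⟨x, y, rfl, hx, hy⟩ := List.sublist_append_iff.1 h
  rcases List.sublist_singleton.1 hy with rfl | rfl
  · simpa using hx
  · simp at ha

theorem sublist_append_concat {L X Y α : List ℕ} {a : ℕ} (h : List.Sublist α (L ++ X))
    (ha : a ∈ Y) : List.Sublist (α ++ [a]) (L ++ (X ++ Y)) := by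
  rw [← List.append_assoc]
  exact h.append (List.singleton_sublist.2 ha)

/-- A new letter `a` that occurs in `H` no earlier than the end of the prefix used so far, the last
letter of that prefix included: if `a` is this letter, then `α`, which does not contain `a`, does
not use it. -/
theorem sublist_concat_of_mem_drop {L H α : List ℕ} {a i : ℕ}
    (h : List.Sublist α (L ++ H.take (i + 1))) (hmem : a ∈ H.drop i) (ha : a ∉ α) :
    List.Sublist (α ++ [a]) (L ++ H) := by
  have hi : i < H.length := by
    by_contra hi
    rw [List.drop_eq_nil_of_le (by omega)] at hmem
    simp at hmem
  rw [List.drop_eq_getElem_cons hi, List.mem_cons] at hmem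
  rcases hmem with rfl | hmem
  · rw [List.take_succ_eq_append_getElem hi, ← List.append_assoc] at h
    refine (sublist_concat_of_not_mem h ha).trans ?_
    rw [List.append_assoc, ← List.take_succ_eq_append_getElem hi]
    exact (List.Sublist.refl _).append (List.take_sublist _ _)
  · have := sublist_append_concat h hmem
    rwa [List.take_append_drop] at this

/-- If each letter missing from `σ` is in `E`, then each letter is among all but the last `d`
letters of the next sequence `E ++ σ.dropLast` or among the last `d + 1` letters of `σ`. -/
theorem mem_take_or_mem_drop {E σ : List ℕ} {a d : ℕ} (h : a ∈ E ∨ a ∈ σ)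
    (hd : d + 1 ≤ σ.length) :
    a ∈ (E ++ σ.dropLast).take ((E ++ σ.dropLast).length - d) ∨
      a ∈ σ.drop (σ.length - 1 - d) := by
  have h1 : (E ++ σ.dropLast).take ((E ++ σ.dropLast).length - d)
      = E ++ σ.take (σ.length - 1 - d) := by
    rw [List.length_append, List.length_dropLast,
      show E.length + (σ.length - 1) - d = E.length + (σ.length - 1 - d) by omega,
      List.take_length_add_append, List.dropLast_eq_take, List.take_take]
    congr 2; omega
  rw [h1, List.mem_append]
  rcases h with h | h
  · exact Or.inl (Or.inl h)
  · rw [← List.take_append_drop (σ.length - 1 - d) σ, List.mem_append] at h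
    tauto

section
variable {r N : ℕ} {α : List ℕ} {a : ℕ}

theorem IsPartialPerm.of_concat {n : ℕ} (h : IsPartialPerm n (α ++ [a])) :
    IsPartialPerm n α ∧ a ∉ α ∧ 1 ≤ a ∧ a ≤ n := by
  obtain ⟨h1, h2⟩ := h
  rw [List.nodup_append] at h1
  refine ⟨⟨h1.1, fun b hb => h2 b (by simp [hb])⟩, fun ha => h1.2.2 a ha a (by simp) rfl, ?_⟩
  exact h2 a (by simp)

theorem IsPartialPerm.countP_le (h : IsPartialPerm (N + r) α) : α.countP (N < ·) ≤ r := by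
  rw [List.countP_eq_length_filter]
  have : (α.filter (N < ·)).Subperm (List.range' (N + 1) r) := by
    refine List.subperm_of_subset (h.1.filter _) fun b hb => ?_
    have h1 := h.2 b (List.mem_of_mem_filter hb)
    have h2 := List.of_mem_filter hb
    simp only [decide_eq_true_eq] at h2
    rw [List.mem_range'_1]; omega
  simpa using this.length_le

theorem skipsLeft_concat_of_le (h : a ≤ N) : skipsLeft r N (α ++ [a]) = skipsLeft r N α := by
  simp [skipsLeft, List.countP_append, h]

theorem skipsLeft_concat_of_lt (hα : IsPartialPerm (N + r) (α ++ [a])) (h : N < a) :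
    skipsLeft r N α = skipsLeft r N (α ++ [a]) + 1 := by
  have := hα.countP_le
  simp only [skipsLeft, List.countP_append, List.countP_singleton, h, decide_true, if_true] at *
  omega

theorem skipsLeft_le : skipsLeft r N α ≤ r := Nat.sub_le _ _

/-- The part of `insertAt W ψ p` that may be used while `U` skip letters are left: all of it but the
last `U` letters if these lie after `ψ` and do not exhaust what follows `ψ`, and otherwise the word
`W` without its last `U` letters, so that nothing of `ψ` is used. -/
def cutAt (W ψ : List ℕ) (p U : ℕ) : List ℕ :=
  if U < W.length - p then (insertAt W ψ p).take (W.length + ψ.length - U)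
  else W.take (W.length - U)

variable {W ψ W' ψ' L : List ℕ} {p p' U : ℕ}

theorem take_insertAt_length_sub (h : U < W.length - p) :
    (insertAt W ψ p).take (W.length + ψ.length - U)
      = W.take p ++ ψ ++ (W.drop p).take (W.length - p - U) := by
  rw [insertAt, show W.length + ψ.length - U = (W.take p ++ ψ).length + (W.length - p - U) by
    simp; omega, List.take_length_add_append]

theorem sublist_insertAt : W.Sublist (insertAt W ψ p) := by
  conv_lhs => rw [← List.take_append_drop p W]
  rw [insertAt, List.append_assoc]
  exact (List.Sublist.refl _).append (List.sublist_append_right _ _)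

theorem cutAt_sublist : (cutAt W ψ p U).Sublist (insertAt W ψ p) := by
  rw [cutAt]
  split_ifs
  · exact List.take_sublist _ _
  · exact (List.take_sublist _ _).trans sublist_insertAt

theorem mem_cutAt_of_mem_take (h : a ∈ W.take (W.length - U)) : a ∈ cutAt W ψ p U := by
  rw [cutAt]
  split_ifs with hU
  · rw [take_insertAt_length_sub hU]
    rw [show W.length - U = p + (W.length - p - U) by omega, List.take_add] at h
    simp only [List.mem_append] at h ⊢
    tauto
  · exact h

theorem sublist_concat_of_mem_drop_cutAt (hp : p ≤ W.length) (hU : U < W.length)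
    (h : α.Sublist (L ++ cutAt W ψ p U)) (hmem : a ∈ W.drop (W.length - 1 - U)) (ha : a ∉ α) :
    (α ++ [a]).Sublist (L ++ insertAt W ψ p) := by
  rw [cutAt] at h
  split_ifs at h with hc
  · rw [take_insertAt_length_sub hc, ← List.append_assoc,
      show W.length - p - U = (W.length - 1 - U - p) + 1 by omega] at h
    rw [show W.length - 1 - U = p + (W.length - 1 - U - p) by omega, ← List.drop_drop] at hmem
    have := sublist_concat_of_mem_drop h hmem ha
    rwa [List.append_assoc] at this
  · rw [show W.length - U = W.length - 1 - U + 1 by omega] at h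
    exact (sublist_concat_of_mem_drop h hmem ha).trans
      ((List.Sublist.refl _).append sublist_insertAt)

theorem exists_concat_of_length {l : List ℕ} {k : ℕ} (h : l.length = k + 1) :
    ∃ l' b, l = l' ++ [b] ∧ l'.length = k := by
  have hne : l ≠ [] := by rintro rfl; simp at h
  exact ⟨l.dropLast, l.getLast hne, (List.dropLast_append_getLast hne).symm, by simp [h]⟩

/-- The induction step of the invariant. By `htrans`, a new skip letter can be placed in the run `ψ`
of the old sequence, if that run has been cut off, or in the run `ψ'` of the new one, if with one
skip letter fewer left that run is not cut off. -/
theorem embed_step {c k : ℕ} (hc1 : 1 ≤ c) (hc2 : c < N) (hr : r + 2 ≤ N)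
    (hp : p ≤ N - 1)
    (htrans : ∀ U, 1 ≤ U → U ≤ r →
      (N - 1 - p ≤ U ∧ ∀ b, N < b → b ≤ N + r → b ∈ ψ) ∨
      (U ≤ N - 1 - p' ∧ ∀ b, N < b → b ≤ N + r → b ∈ ψ'))
    (ih : ∀ α, IsPartialPerm (N + r) α → α.length = k →
      α.Sublist (L ++ cutAt (cyc N (c + 1)) ψ p (skipsLeft r N α)))
    {α : List ℕ} (hα : IsPartialPerm (N + r) α) (hk : α.length = k + 1) :
    α.Sublist (L ++ insertAt (cyc N (c + 1)) ψ p
      ++ cutAt (cyc N c) ψ' p' (skipsLeft r N α)) := by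
  obtain ⟨β, a, rfl, hβ⟩ := exists_concat_of_length hk
  obtain ⟨hβ1, haβ, ha1, ha2⟩ := hα.of_concat
  have h := ih β hβ1 hβ
  have hl := length_cyc (N := N) (c := c + 1) (by omega) (by omega)
  have hl' := length_cyc (N := N) (c := c) (by omega) (by omega)
  have hle := skipsLeft_le (r := r) (N := N) (α := β)
  have hfull : ∀ {X}, (β ++ [a]).Sublist (L ++ insertAt (cyc N (c + 1)) ψ p) →
      (β ++ [a]).Sublist (L ++ insertAt (cyc N (c + 1)) ψ p ++ X) :=
    fun h => h.trans (List.sublist_append_left _ _)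
  have hnew : ∀ {X}, a ∈ X →
      (β ++ [a]).Sublist (L ++ insertAt (cyc N (c + 1)) ψ p ++ X) := fun hX =>
    (h.trans ((List.Sublist.refl _).append cutAt_sublist)).append (List.singleton_sublist.2 hX)
  rcases le_or_gt a N with ha | ha
  · rw [skipsLeft_concat_of_le ha]
    have hmem : a ∈ [c + 1] ∨ a ∈ cyc N (c + 1) := by
      rw [mem_cyc (by omega) (by omega), List.mem_singleton]; omega
    rcases mem_take_or_mem_drop (d := skipsLeft r N β) hmem (by omega) with h1 | h1
    · rw [List.singleton_append, ← cyc_eq_cons hc1 hc2] at h1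
      exact hnew (mem_cutAt_of_mem_take h1)
    · exact hfull (sublist_concat_of_mem_drop_cutAt (by omega) (by omega) h h1 haβ)
  · have hU := skipsLeft_concat_of_lt hα ha
    rcases htrans (skipsLeft r N β) (by omega) hle with ⟨h1, h2⟩ | ⟨h1, h2⟩
    · refine hfull ?_
      rw [cutAt, if_neg (by omega)] at h
      have h3 : β.Sublist (L ++ (cyc N (c + 1)).take p) := by
        refine h.trans ((List.Sublist.refl _).append ?_)
        exact List.take_sublist_take_left (by omega)
      have h4 := sublist_append_concat h3 (h2 a ha ha2)
      refine h4.trans ((List.Sublist.refl _).append ?_)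
      rw [insertAt]
      exact List.sublist_append_left _ _
    · refine hnew ?_
      rw [cutAt, if_pos (by omega), take_insertAt_length_sub (by omega)]
      simp [h2 a ha ha2]

/-- The closed form of the first `s + 1` sequences. -/
def startBlock (n k : ℕ) : List ℕ := List.range' (n + 3 - k) (k - 2) ++ List.range' 1 (n + 1 - k)

theorem startBlock_succ {n k : ℕ} (h1 : 1 ≤ k) (h2 : k < n) :
    startBlock n (k + 1) =
      List.range' (n + 2 - k) (min (k - 1) 1) ++ (startBlock n k).dropLast := by
  rw [startBlock, startBlock, List.dropLast_append_of_ne_nil (by simp; omega), dropLast_range',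
    ← List.append_assoc]
  congr 1
  · match k, h1 with
    | 1, _ => simp
    | k + 2, _ =>
      rw [show min (k + 2 - 1) 1 = 1 by omega, show k + 2 + 1 - 2 = k + 1 by omega,
        List.range'_succ]
      simp only [List.range'_one, List.singleton_append]
      congr 1
      · omega
      · congr 1; omega

theorem mem_startBlock {n k : ℕ} (h1 : 1 ≤ k) (h2 : k ≤ n) :
    a ∈ startBlock n k ↔ 1 ≤ a ∧ a ≤ n ∧ (k = 1 ∨ a ≠ n + 2 - k) := by
  simp only [startBlock, List.mem_append, List.mem_range'_1]; omega

/-- The number of letters to be cut from the end of one of the first `s + 1` sequences: the number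
of skip letters left, but none while `α` has skip letters only. -/
def startCut (r N : ℕ) (α : List ℕ) : ℕ :=
  if ∀ b ∈ α, N < b then 0 else skipsLeft r N α

/-- The invariant for the first `s + 1` sequences. -/
theorem embed_start (hN : r + 3 ≤ N) {k : ℕ} (hk : k ≤ r + 1) {α : List ℕ}
    (hα : IsPartialPerm (N + r) α) (hl : α.length = k + 1) :
    α.Sublist (prefixCat (r + 1) (N + r) k ++ (startBlock (N + r) (k + 1)).take
      ((startBlock (N + r) (k + 1)).length - startCut r N α)) := by
  induction k generalizing α with
  | zero =>
    obtain ⟨β, a, rfl, hβ⟩ := exists_concat_of_length hl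
    obtain ⟨-, -, ha1, ha2⟩ := hα.of_concat
    rw [List.length_eq_zero_iff] at hβ
    subst hβ
    simp only [List.nil_append]
    rw [List.singleton_sublist, List.mem_append]
    right
    simp only [startCut, skipsLeft, startBlock, List.mem_singleton, forall_eq]
    simp only [Nat.zero_add, List.length_append, List.length_range']
    split_ifs with h
    · simp [List.mem_range'_1]; omega
    · have : List.countP (fun x => decide (N < x)) [a] = 0 := by simpa using h
      rw [this, show N + r + 1 - 1 = N + r by omega, show 1 - 2 + (N + r) - (r - 0) = N by omega,
        show 1 - 2 = 0 by omega, ← List.range'_append_1, List.range'_zero, List.nil_append,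
        List.take_left' (by simp), List.mem_range'_1]
      omega
  | succ k ih =>
    obtain ⟨β, a, rfl, hβ⟩ := exists_concat_of_length hl
    obtain ⟨hβ1, haβ, ha1, ha2⟩ := hα.of_concat
    have h := ih (by omega) hβ1 hβ
    have hs : seqT (r + 1) (N + r) (k + 1) = startBlock (N + r) (k + 1) :=
      seqT_start (by omega) (by omega) (by omega)
    have hσ := startBlock_succ (n := N + r) (k := k + 1) (by omega) (by omega)
    have hlen : N + r - 1 ≤ (startBlock (N + r) (k + 1)).length := by
      simp [startBlock]; omega
    rw [prefixCat_succ, hs]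
    have hnew : ∀ {X}, a ∈ X → (β ++ [a]).Sublist
        (prefixCat (r + 1) (N + r) k ++ startBlock (N + r) (k + 1) ++ X) := fun hX =>
      (h.trans ((List.Sublist.refl _).append (List.take_sublist _ _))).append
        (List.singleton_sublist.2 hX)
    have hle : startCut r N (β ++ [a]) ≤ r := by
      rw [startCut]; split_ifs
      · omega
      · exact skipsLeft_le
    by_cases hd : startCut r N (β ++ [a]) ≤ startCut r N β
    · have hmem : a ∈ List.range' (N + r + 2 - (k + 1)) (min (k + 1 - 1) 1) ∨
          a ∈ startBlock (N + r) (k + 1) := by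
        rw [mem_startBlock (by omega) (by omega), List.mem_range'_1]; omega
      rcases mem_take_or_mem_drop (d := startCut r N (β ++ [a])) hmem (by omega) with h1 | h1
      · rw [← hσ] at h1
        exact hnew h1
      · refine (sublist_concat_of_mem_drop ?_ h1 haβ).trans (List.sublist_append_left _ _)
        refine h.trans ((List.Sublist.refl _).append (List.take_sublist_take_left ?_))
        omega
    -- The cut grows only when the first normal letter comes after skip letters alone.
    · have h1 : ∀ b ∈ β, N < b := by
        by_contra hb
        apply hd
        have hb' : ¬ ∀ b ∈ β ++ [a], N < b := fun hh => hb fun b hbb => hh b (by simp [hbb])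
        rw [startCut, startCut, if_neg hb, if_neg hb']
        rcases le_or_gt a N with ha | ha
        · rw [skipsLeft_concat_of_le ha]
        · have := skipsLeft_concat_of_lt hα ha; omega
      have h2 : ¬ ∀ b ∈ β ++ [a], N < b := by
        intro hb; apply hd; rw [startCut, if_pos hb]; omega
      have h3 : a ≤ N := by
        by_contra ha
        apply h2
        intro b hb
        rw [List.mem_append, List.mem_singleton] at hb
        rcases hb with hb | rfl
        · exact h1 b hb
        · omega
      have h4 : β.countP (N < ·) = k + 1 := by
        rw [← hβ, List.countP_eq_length]; simpa using h1
      have h5 := hβ1.countP_le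
      apply hnew
      rw [startCut, if_neg h2, skipsLeft_concat_of_le h3, skipsLeft, h4]
      have e : startBlock (N + r) (k + 1 + 1) =
        (List.range' (N + r + 3 - (k + 1 + 1)) (k + 1 + 1 - 2)
        ++ List.range' 1 N) ++ List.range' (N + 1) (r - (k + 1)) := by
        rw [startBlock, List.append_assoc,
          show N + r + 1 - (k + 1 + 1) = N + (r - (k + 1)) by omega, Nat.add_comm N 1,
          List.range'_append_1]
      rw [e, List.take_left']
      · simp [List.mem_range'_1]; omega
      · simp; omega
end

section
variable {r N Q : ℕ}

theorem skipPos_le {t : ℕ} (hN : 3 * r + 5 ≤ N) (ht : t < 2 * r + 1) :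
    skipPos r N t ≤ N - 1 := by
  rw [skipPos]; split_ifs <;> omega

theorem mem_skipWord {t b : ℕ} (ht : t ≠ r) (h1 : N < b) (h2 : b ≤ N + r) :
    b ∈ skipWord r N t := by
  rw [skipWord]
  split_ifs
  · rw [List.mem_range'_1]; omega
  · rw [List.mem_reverse, List.mem_range'_1]; omega

/-- The invariant for `s + 2 ≤ k < n - s`. -/
theorem embed_mid (hr : 1 ≤ r) (hN : 3 * r + 5 ≤ N) {j : ℕ} (hj : r + 5 + j ≤ N) {α : List ℕ}
    (hα : IsPartialPerm (N + r) α) (hl : α.length = r + 3 + j) :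
    α.Sublist (prefixCat (r + 1) (N + r) (r + 2 + j) ++
      cutAt (cyc N (N - 1 - j)) (skipWord r N (j % (2 * r + 1)))
        (skipPos r N (j % (2 * r + 1))) (skipsLeft r N α)) := by
  induction j generalizing α with
  | zero =>
    have hs : seqT (r + 1) (N + r) (r + 2) = insertAt (cyc N N) (List.range' (N + 1) r) 0 := by
      rw [seqT_start (by omega) (by omega) le_rfl]
      simp only [insertAt, cyc, List.take_zero, List.drop_zero, Nat.sub_self, List.range'_zero,
        List.nil_append]
      congr 2 <;> omega
    have hs' : startBlock (N + r) (r + 2) = insertAt (cyc N N) (List.range' (N + 1) r) 0 := by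
      rw [← hs, seqT_start (by omega) (by omega) le_rfl, startBlock]
    have hlen := length_cyc (N := N) (c := N) (by omega) le_rfl
    rw [Nat.add_zero, Nat.zero_mod, prefixCat_succ, hs]
    have := @embed_step r N (List.range' (N + 1) r) (skipWord r N 0)
      (prefixCat (r + 1) (N + r) (r + 1)) 0 (skipPos r N 0) (N - 1) (r + 2) (by omega) (by omega)
      (by omega) (by omega) ?_ ?_ α hα (by omega)
    · rwa [show N - 1 + 1 = N by omega] at this
    · intro U hU1 hU2
      refine Or.inr ⟨?_, fun b h1 h2 => mem_skipWord (by omega) h1 h2⟩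
      rw [skipPos, if_pos (by omega)]; omega
    · intro β hβ hβl
      have h := embed_start (by omega) le_rfl hβ hβl
      have hle := skipsLeft_le (r := r) (N := N) (α := β)
      rw [show N - 1 + 1 = N by omega, cutAt, if_pos (by omega), hlen]
      have hc : ¬ ∀ b ∈ β, N < b := by
        intro hb
        have h4 : β.countP (N < ·) = β.length := by
          rw [List.countP_eq_length]; simpa using hb
        have := hβ.countP_le
        omega
      rw [startCut, if_neg hc, hs', length_insertAt, hlen] at h
      exact h
  | succ j ih =>
    have ht := Nat.mod_lt j (show 2 * r + 1 > 0 by omega)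
    rw [show r + 2 + (j + 1) = r + 2 + j + 1 by omega, prefixCat_succ,
      show r + 2 + j + 1 = r + 3 + j by omega, seqT_mid hr hN (by omega), midBlock,
      succ_mod_eq r j hr]
    have ih' := @ih (by omega)
    generalize j % (2 * r + 1) = t at ht ih' ⊢
    rw [show N - 1 - j = N - 1 - (j + 1) + 1 by omega] at ih' ⊢
    refine embed_step (by omega) (by omega) (by omega) (skipPos_le hN ht) ?_
      (fun β h1 h2 => ih' h1 h2) hα hl
    intro U hU1 hU2
    -- The new skip letter goes into the old sequence exactly when the run was cut off there,
    -- that is in the phase `t < r` with at most `U` normal letters after the run.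
    by_cases h0 : t = 2 * r
    · rw [if_pos h0]
      refine Or.inr ⟨?_, fun b h1 h2 => mem_skipWord (by omega) h1 h2⟩
      rw [skipPos, if_pos (by omega)]; omega
    · rw [if_neg h0]
      by_cases h1 : r ≤ t
      · refine Or.inr ⟨?_, fun b h1 h2 => mem_skipWord (by omega) h1 h2⟩
        rw [skipPos, if_neg (by omega)]; omega
      · by_cases h2 : r - t ≤ U
        · refine Or.inl ⟨?_, fun b h1 h2 => mem_skipWord (by omega) h1 h2⟩
          rw [skipPos, if_pos (by omega)]; omega
        · refine Or.inr ⟨?_, fun b h1 h2 => mem_skipWord (by omega) h1 h2⟩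
          rw [skipPos, if_pos (by omega)]; omega

theorem eq_concat_lastLetter {l : List ℕ} (h : l ≠ []) : l = l.dropLast ++ [lastLetter l] := by
  conv_lhs => rw [← List.dropLast_append_getLast h]
  rw [lastLetter, List.getLastD_eq_getLast?, List.getLast?_eq_some_getLast h]
  rfl

theorem embed_succ {s n k : ℕ}
    (hk : ∀ a, 1 ≤ a → a ≤ n → a ∈ seqT s n (k + 2) ∨
      seqT s n (k + 1) ≠ [] ∧ lastLetter (seqT s n (k + 1)) = a)
    (ih : ∀ α, IsPartialPerm n α → α.length = k + 1 → α.Sublist (prefixCat s n (k + 1)))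
    {α : List ℕ} (hα : IsPartialPerm n α) (hl : α.length = k + 2) :
    α.Sublist (prefixCat s n (k + 2)) := by
  obtain ⟨β, a, rfl, hβ⟩ := exists_concat_of_length hl
  obtain ⟨hβ1, haβ, ha1, ha2⟩ := hα.of_concat
  have h := ih β hβ1 hβ
  rw [prefixCat_succ]
  rcases hk a ha1 ha2 with h1 | ⟨h1, rfl⟩
  · exact h.append (List.singleton_sublist.2 h1)
  · rw [prefixCat_succ, eq_concat_lastLetter h1, ← List.append_assoc] at h
    refine (sublist_concat_of_not_mem h haβ).trans ?_
    rw [List.append_assoc, ← eq_concat_lastLetter h1, ← prefixCat_succ]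
    exact List.sublist_append_left _ _

theorem mem_lastWord {a : ℕ} (hN : 3 * r + 5 ≤ N) : a ∈ lastWord r N ↔ 1 ≤ a ∧ a ≤ N := by
  simp only [lastWord, List.mem_append, List.mem_range'_1]; omega

/-- From `σ_{n-s}` on, every letter that is missing from a sequence is the last letter of the
sequence before it. -/
theorem seqT_end_cases (hr : 1 ≤ r) (hN : 3 * r + 5 ≤ N) (hQ : N + r = 3 + (2 * r + 1) * Q)
    {k : ℕ} (h1 : N - 3 ≤ k) (h2 : k + 2 ≤ N + r) (a : ℕ) (ha1 : 1 ≤ a) (ha2 : a ≤ N + r) :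
    a ∈ seqT (r + 1) (N + r) (k + 2) ∨
      seqT (r + 1) (N + r) (k + 1) ≠ [] ∧ lastLetter (seqT (r + 1) (N + r) (k + 1)) = a := by
  have hne : ∀ l : List ℕ, lastLetter l = a → l ≠ [] := by
    rintro l h rfl
    rw [lastLetter, List.getLastD_nil] at h
    omega
  suffices h : a ∉ seqT (r + 1) (N + r) (k + 2) →
      lastLetter (seqT (r + 1) (N + r) (k + 1)) = a from
    or_iff_not_imp_left.2 fun h' => ⟨hne _ (h h'), h h'⟩
  intro hmem
  rcases Nat.lt_or_ge k (N - 2) with hk | hk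
  · obtain ⟨j, rfl⟩ : ∃ j, N = r + 5 + j := ⟨N - (r + 5), by omega⟩
    rw [show k + 2 = r + 5 + j - 1 by omega, seqT_penult hr hN hQ, List.mem_append,
      mem_cyc (by omega) (by omega), List.mem_reverse, List.mem_range'_1] at hmem
    rw [show k + 1 = r + 3 + j by omega, seqT_mid hr hN (by omega),
      lastLetter_midBlock hr hN (by omega)]
    omega
  rcases Nat.lt_or_ge (k + 2) (N + r) with hk' | hk'
  · rw [show k + 2 = N + (k + 2 - N) by omega, seqT_end hr hN hQ (by omega)] at hmem
    simp only [List.mem_append, List.mem_reverse, List.mem_range'_1, mem_lastWord hN] at hmem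
    rcases Nat.eq_or_lt_of_le hk with h | h
    · rw [show k + 1 = N - 1 by omega, seqT_penult hr hN hQ,
        lastLetter_append_reverse_range' _ _ hr]
      omega
    · rw [show k + 1 = N + (k + 1 - N) by omega, seqT_end hr hN hQ (by omega),
        lastLetter_append_reverse_range' _ _ (by omega)]
      omega
  · exfalso
    apply hmem
    rw [show k + 2 = N + r by omega, seqT_last hr hN hQ, List.mem_append, List.mem_reverse,
      List.mem_range'_1, mem_lastWord hN]
    omega

/-- Every list of `k` distinct letters is a subsequence of `σ_1 ⋯ σ_k`. -/
theorem sublist_prefixCat (hr : 1 ≤ r) (hN : 3 * r + 5 ≤ N) (hQ : N + r = 3 + (2 * r + 1) * Q)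
    {α : List ℕ} (hα : IsPartialPerm (N + r) α) (hl : α.length ≤ N + r) :
    α.Sublist (prefixCat (r + 1) (N + r) α.length) := by
  generalize hk : α.length = k at hl
  match k with
  | 0 => simp [List.length_eq_zero_iff.1 hk]
  | k + 1 =>
    rcases Nat.lt_or_ge k (r + 2) with h | h
    · rw [prefixCat_succ, seqT_start (by omega) (by omega) (by omega)]
      exact (embed_start (by omega) (by omega) hα hk).trans
        ((List.Sublist.refl _).append (List.take_sublist _ _))
    · have hmid : ∀ {k}, r + 2 ≤ k → k ≤ N - 3 → ∀ α, IsPartialPerm (N + r) α →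
          α.length = k + 1 → α.Sublist (prefixCat (r + 1) (N + r) (k + 1)) := by
        intro k h1 h2 α hα hk
        obtain ⟨j, rfl⟩ : ∃ j, k = r + 2 + j := ⟨k - (r + 2), by omega⟩
        rw [prefixCat_succ, show r + 2 + j + 1 = r + 3 + j by omega, seqT_mid hr hN (by omega)]
        exact (embed_mid hr hN (by omega) hα (by omega)).trans
          ((List.Sublist.refl _).append cutAt_sublist)
      rcases Nat.lt_or_ge (N - 3) k with h' | h'
      · have hend : ∀ i, N - 3 + i + 1 ≤ N + r → ∀ α, IsPartialPerm (N + r) α →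
            α.length = N - 3 + i + 1 →
            α.Sublist (prefixCat (r + 1) (N + r) (N - 3 + i + 1)) := by
          intro i
          induction i with
          | zero => intro _ α hα hl; exact hmid (by omega) le_rfl α hα hl
          | succ i ih =>
            intro hi α hα hl
            exact embed_succ (seqT_end_cases hr hN hQ (by omega) (by omega)) (ih (by omega)) hα hl
        have := hend (k - (N - 3)) (by omega) α hα (by omega)
        rwa [show N - 3 + (k - (N - 3)) + 1 = k + 1 by omega] at this
      · exact hmid h h' α hα hk
end

/-! ### The reversal symmetry -/

/-- The involution `a ↦ s + 2 - a` modulo `N` of the normal letters, with the skip letters fixed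
(`s = r + 1`). -/
def reflect (r N a : ℕ) : ℕ :=
  if 1 ≤ a ∧ a ≤ r + 2 then r + 3 - a else if r + 3 ≤ a ∧ a ≤ N then N + r + 3 - a else a

/-- The reversed word with its letters relabelled by `reflect`. -/
def mirror (r N : ℕ) (l : List ℕ) : List ℕ := l.reverse.map (reflect r N)

section
variable {r N Q : ℕ}

theorem reflect_reflect (a : ℕ) : reflect r N (reflect r N a) = a := by
  simp only [reflect]; split_ifs <;> omega

theorem mirror_mirror (l : List ℕ) : mirror r N (mirror r N l) = l := by
  have : reflect r N ∘ reflect r N = id := funext reflect_reflect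
  simp [mirror, List.map_reverse, this]

theorem mirror_append (l₁ l₂ : List ℕ) :
    mirror r N (l₁ ++ l₂) = mirror r N l₂ ++ mirror r N l₁ := by
  simp [mirror]

theorem length_mirror (l : List ℕ) : (mirror r N l).length = l.length := by simp [mirror]

theorem mirror_sublist {l₁ l₂ : List ℕ} (h : l₁.Sublist l₂) :
    (mirror r N l₁).Sublist (mirror r N l₂) := h.reverse.map _

theorem mirror_flatten (L : List (List ℕ)) :
    mirror r N L.flatten = ((L.map (mirror r N)).reverse).flatten := by
  induction L with
  | nil => rfl
  | cons l L ih => simp [mirror_append, ih]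

theorem mirror_range' {a b m : ℕ} (h : ∀ i < m, reflect r N (a + m - 1 - i) = b + i) :
    mirror r N (List.range' a m) = List.range' b m := by
  refine List.ext_getElem (by simp [mirror]) fun i h1 h2 => ?_
  simp only [List.length_range'] at h2
  simp only [mirror, List.getElem_map, List.getElem_reverse, List.getElem_range',
    List.length_range', Nat.one_mul]
  rw [← h i h2]
  congr 1; omega

theorem mirror_range'_low {a m : ℕ} (h1 : 1 ≤ a) (h2 : a + m ≤ r + 3) :
    mirror r N (List.range' a m) = List.range' (r + 4 - a - m) m :=
  mirror_range' fun i hi => by rw [reflect, if_pos (by omega)]; omega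

theorem mirror_range'_high {a m : ℕ} (h1 : r + 3 ≤ a) (h2 : a + m ≤ N + 1) :
    mirror r N (List.range' a m) = List.range' (N + r + 4 - a - m) m :=
  mirror_range' fun i hi => by rw [reflect, if_neg (by omega), if_pos (by omega)]; omega

theorem mirror_range'_skip {a m : ℕ} (h : r + 2 ≤ N) (h1 : N < a) :
    mirror r N (List.range' a m) = (List.range' a m).reverse := by
  rw [mirror]
  refine (List.map_congr_left fun x hx => ?_).trans (List.map_id _)
  rw [List.mem_reverse, List.mem_range'_1] at hx
  rw [reflect, if_neg (by omega), if_neg (by omega), id]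

theorem mirror_reverse_range'_skip {a m : ℕ} (h : r + 2 ≤ N) (h1 : N < a) :
    mirror r N (List.range' a m).reverse = List.range' a m := by
  rw [← mirror_range'_skip h h1, mirror_mirror]

theorem mirror_range'_one {M : ℕ} (h1 : r + 2 ≤ M) (h2 : M ≤ N) :
    mirror r N (List.range' 1 M) = List.range' (N + r + 3 - M) (M - (r + 2)) ++
      List.range' 1 (r + 2) := by
  obtain ⟨d, rfl⟩ : ∃ d, M = (r + 2) + d := ⟨M - (r + 2), by omega⟩
  rw [← List.range'_append_1, mirror_append, mirror_range'_low le_rfl (by omega),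
    mirror_range'_high (by omega) (by omega)]
  congr 2 <;> omega

theorem mirror_cyc {c : ℕ} (h1 : r + 3 ≤ c) (h2 : c ≤ N) :
    mirror r N (cyc N c) = cyc N (N + r + 3 - c) := by
  rw [cyc, cyc, mirror_append, mirror_range'_one (by omega) (by omega),
    mirror_range'_high (by omega) (by omega),
    show N + r + 3 - c - 1 = r + 2 + (N - c) by omega,
    ← List.range'_append_1 (m := r + 2) (n := N - c),
    List.append_assoc, show N + r + 3 - (c - 1) = N + r + 3 - c + 1 by omega,
    show c - 1 - (r + 2) = N - (N + r + 3 - c) by omega,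
    show N + r + 4 - (c + 1) - (N - c) = 1 + (r + 2) by omega]

theorem mirror_insertAt {W ψ : List ℕ} {p : ℕ} :
    mirror r N (insertAt W ψ p) = insertAt (mirror r N W) (mirror r N ψ) (W.length - p) := by
  rw [insertAt, insertAt, mirror_append, mirror_append]
  simp only [mirror, ← List.map_take, ← List.map_drop, List.append_assoc]
  congr 2
  · rw [List.take_reverse]
    rcases le_total p W.length with h | h
    · congr 2; omega
    · rw [Nat.sub_eq_zero_of_le h, Nat.sub_zero, List.drop_of_length_le h,
        List.drop_of_length_le le_rfl]
  · rw [List.drop_reverse]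
    rcases le_total p W.length with h | h
    · congr 3; omega
    · rw [Nat.sub_eq_zero_of_le h, Nat.sub_zero, List.take_of_length_le h, List.take_length]

theorem mirror_skipWord (hN : r + 2 ≤ N) {t : ℕ} (ht : t < 2 * r + 1) :
    mirror r N (skipWord r N t) = skipWord r N (2 * r - t) := by
  rw [skipWord, skipWord]
  split_ifs
  all_goals first | omega | rfl | exact mirror_range'_skip hN (by omega) |
    exact mirror_reverse_range'_skip hN (by omega)

theorem insertAt_nil (W : List ℕ) (p : ℕ) : insertAt W [] p = W := by simp [insertAt]

theorem mirror_midBlock (hN : 3 * r + 5 ≤ N) (hQ : N + r = 3 + (2 * r + 1) * Q) {j : ℕ}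
    (hj : r + 5 + j ≤ N) : mirror r N (midBlock r N j) = midBlock r N (N - (r + 5) - j) := by
  have ht := Nat.mod_lt j (show 2 * r + 1 > 0 by omega)
  have hmod : (N - (r + 5) - j) % (2 * r + 1) = 2 * r - j % (2 * r + 1) := by
    have h1 : N - (r + 5) - j + 1 + j = (2 * r + 1) * (Q - 1) := by
      rw [Nat.mul_sub]; omega
    have h2 : N - (r + 5) - j + 1 + j % (2 * r + 1) ≡ 0 [MOD 2 * r + 1] := by
      refine (Nat.ModEq.add_left _ (Nat.mod_modEq j _)).trans ?_
      rw [h1]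
      simp [Nat.ModEq]
    refine (Nat.mod_eq_iff.2 (Or.inr ⟨by omega, ?_⟩))
    obtain ⟨d, hd⟩ := (Nat.modEq_zero_iff_dvd).1 h2
    refine ⟨d - 1, ?_⟩
    have : 1 ≤ d := by
      rcases Nat.eq_zero_or_pos d with rfl | h
      · omega
      · exact h
    rw [Nat.mul_sub]
    have : 2 * r + 1 ≤ (2 * r + 1) * d := Nat.le_mul_of_pos_right _ this
    omega
  rw [midBlock, midBlock, hmod, mirror_insertAt, mirror_cyc (by omega) (by omega),
    mirror_skipWord (by omega) ht, length_cyc (by omega) (by omega),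
    show N + r + 3 - (N - 1 - j) = N - 1 - (N - (r + 5) - j) by omega]
  generalize j % (2 * r + 1) = t at ht
  by_cases h : t = r
  · subst h
    rw [show skipWord t N (2 * t - t) = [] by
      rw [skipWord, if_neg (by omega), if_pos (by omega)], insertAt_nil, insertAt_nil]
  · congr 1
    rw [skipPos, skipPos]
    split_ifs <;> omega

theorem seqT_start_split {k : ℕ} (hN : 3 ≤ N) (h1 : 1 ≤ k) (h2 : k ≤ r + 1) :
    seqT (r + 1) (N + r) k = List.range' (N + r + 3 - k) (k - 2) ++ List.range' 1 N ++
      List.range' (N + 1) (r + 1 - k) := by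
  rw [seqT_start hN h1 (by omega), List.append_assoc, show N + r + 1 - k = N + (r + 1 - k) by omega,
    Nat.add_comm N 1, List.range'_append_1]

theorem mirror_seqT_start (hr : 1 ≤ r) (hN : 3 * r + 5 ≤ N) (hQ : N + r = 3 + (2 * r + 1) * Q)
    {k : ℕ} (h1 : 1 ≤ k) (h2 : k ≤ r + 2) :
    mirror r N (seqT (r + 1) (N + r) k) = seqT (r + 1) (N + r) (N + r + 1 - k) := by
  rcases Nat.eq_or_lt_of_le h2 with rfl | h3
  · rw [show N + r + 1 - (r + 2) = N - 1 by omega, seqT_penult hr hN hQ,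
      seqT_start (by omega) h1 le_rfl, show N + r + 1 - (r + 2) = N - 1 by omega,
      show N + r + 3 - (r + 2) = N + 1 by omega, mirror_append,
      mirror_range'_skip (a := N + 1) (by omega) (by omega), Nat.add_sub_cancel]
    congr 1
    have : List.range' 1 (N - 1) = cyc N N := by simp [cyc]
    rw [this, mirror_cyc (by omega) le_rfl]
    congr 1; omega
  · rw [seqT_start_split (by omega) h1 (by omega), mirror_append, mirror_append,
      mirror_range'_skip (a := N + 1) (by omega) (by omega),
      mirror_range'_skip (a := N + r + 3 - k) (by omega) (by omega),
      mirror_range'_one (by omega) le_rfl]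
    have : List.range' (N + r + 3 - N) (N - (r + 2)) ++ List.range' 1 (r + 2) = lastWord r N := by
      rw [lastWord]; congr 2; omega
    rw [this]
    match k, h1 with
    | 1, _ => simp [seqT_last hr hN hQ]
    | k + 2, _ =>
      rw [show N + r + 1 - (k + 2) = N + (r + 1 - (k + 2)) by omega, seqT_end hr hN hQ (by omega),
        List.append_assoc]
      congr 4 <;> omega

/-- The relabelled reversal of `T_s(n)` is `T_s(n)` itself. -/
theorem mirror_seqT (hr : 1 ≤ r) (hN : 3 * r + 5 ≤ N) (hQ : N + r = 3 + (2 * r + 1) * Q)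
    {k : ℕ} (h1 : 1 ≤ k) (h2 : k ≤ N + r) :
    mirror r N (seqT (r + 1) (N + r) k) = seqT (r + 1) (N + r) (N + r + 1 - k) := by
  rcases Nat.lt_or_ge k (r + 3) with h | h
  · exact mirror_seqT_start hr hN hQ h1 (by omega)
  rcases Nat.lt_or_ge (N - 2) k with h' | h'
  · have := mirror_seqT_start hr hN hQ (k := N + r + 1 - k) (by omega) (by omega)
    rw [show N + r + 1 - (N + r + 1 - k) = k by omega] at this
    rw [← this, mirror_mirror]
  · obtain ⟨j, rfl⟩ : ∃ j, k = r + 3 + j := ⟨k - (r + 3), by omega⟩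
    rw [show N + r + 1 - (r + 3 + j) = r + 3 + (N - (r + 5) - j) by omega,
      seqT_mid hr hN (by omega), seqT_mid hr hN (by omega), mirror_midBlock hN hQ (by omega)]

theorem mirror_listT (hr : 1 ≤ r) (hN : 3 * r + 5 ≤ N) (hQ : N + r = 3 + (2 * r + 1) * Q) :
    ((listT (r + 1) (N + r)).map (mirror r N)).reverse = listT (r + 1) (N + r) := by
  refine List.ext_getElem (by simp) fun i h1 h2 => ?_
  simp only [listT, List.length_map, List.length_range] at h2
  simp only [listT, List.getElem_reverse, List.getElem_map, List.getElem_range, List.length_map,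
    List.length_range]
  rw [mirror_seqT hr hN hQ (by omega) (by omega)]
  congr 1; omega

theorem flatten_take_listT {s n k : ℕ} (hk : k ≤ n) :
    ((listT s n).take k).flatten = prefixCat s n k := by
  rw [listT, prefixCat, ← List.map_take, List.take_range, Nat.min_eq_left hk]

theorem IsPartialPerm.mirror (hN : r + 2 ≤ N) {α : List ℕ} (h : IsPartialPerm (N + r) α) :
    IsPartialPerm (N + r) (mirror r N α) := by
  refine ⟨(List.nodup_reverse.2 h.1).map
    (Function.LeftInverse.injective (g := reflect r N) reflect_reflect), fun a ha => ?_⟩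
  rw [_root_.mirror, List.mem_map] at ha
  obtain ⟨b, hb, rfl⟩ := ha
  have := h.2 b (List.mem_reverse.1 hb)
  rw [reflect]; split_ifs <;> omega

/-- Every list of `n - k` distinct letters is a subsequence of `σ_{k+1} ⋯ σ_n`. -/
theorem sublist_drop_listT (hr : 1 ≤ r) (hN : 3 * r + 5 ≤ N) (hQ : N + r = 3 + (2 * r + 1) * Q)
    {β : List ℕ} (hβ : IsPartialPerm (N + r) β) {k : ℕ} (hk : k + β.length = N + r) :
    β.Sublist ((listT (r + 1) (N + r)).drop k).flatten := by
  have h := sublist_prefixCat hr hN hQ (hβ.mirror (by omega)) (by rw [length_mirror]; omega)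
  rw [length_mirror, ← flatten_take_listT (by omega), ← mirror_listT hr hN hQ, List.take_reverse,
    ← List.map_drop, ← mirror_flatten] at h
  have h2 := mirror_sublist (r := r) (N := N) h
  rw [mirror_mirror, mirror_mirror] at h2
  have : (List.map (_root_.mirror r N) (listT (r + 1) (N + r))).length - β.length = k := by
    simp [listT]; omega
  rwa [this] at h2
end

/-! ### Letters and lengths -/

section
variable {r N Q : ℕ}

theorem mem_midBlock {j a : ℕ} (hj : r + 5 + j ≤ N)
    (ha : a ∈ midBlock r N j) : 1 ≤ a ∧ a ≤ N + r := by
  simp only [midBlock, insertAt, List.mem_append] at ha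
  have hc : a ∈ cyc N (N - 1 - j) → 1 ≤ a ∧ a ≤ N + r := fun h => by
    rw [mem_cyc (by omega) (by omega)] at h; omega
  rcases ha with (ha | ha) | ha
  · exact hc (List.mem_of_mem_take ha)
  · rw [skipWord] at ha
    split_ifs at ha
    · rw [List.mem_range'_1] at ha; omega
    · simp at ha
    · rw [List.mem_reverse, List.mem_range'_1] at ha; omega
  · exact hc (List.mem_of_mem_drop ha)

theorem length_midBlock {j : ℕ} (hj : r + 5 + j ≤ N) :
    (midBlock r N j).length = if j % (2 * r + 1) = r then N - 1 else N - 1 + r := by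
  rw [midBlock, length_insertAt, length_cyc (by omega) (by omega), skipWord]
  split_ifs <;> first | omega | simp

theorem length_seqT_start {k : ℕ} (hN : 3 ≤ N) (h1 : 1 ≤ k) (h2 : k ≤ r + 2) :
    (seqT (r + 1) (N + r) k).length = if k = 1 then N + r else N + r - 1 := by
  rw [seqT_start hN h1 h2]
  split_ifs <;> simp <;> omega

theorem length_seqT_end (hr : 1 ≤ r) (hN : 3 * r + 5 ≤ N) (hQ : N + r = 3 + (2 * r + 1) * Q)
    {k : ℕ} (h1 : N - 1 ≤ k) (h2 : k ≤ N + r) :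
    (seqT (r + 1) (N + r) k).length = if k = N + r then N + r else N + r - 1 := by
  have h := length_seqT_start (r := r) (N := N) (k := N + r + 1 - k) (by omega) (by omega)
    (by omega)
  have h3 := mirror_seqT hr hN hQ (k := N + r + 1 - k) (by omega) (by omega)
  rw [show N + r + 1 - (N + r + 1 - k) = k by omega] at h3
  rw [← h3, length_mirror, h]
  split_ifs <;> omega

theorem mem_seqT (hr : 1 ≤ r) (hN : 3 * r + 5 ≤ N) (hQ : N + r = 3 + (2 * r + 1) * Q)
    {k a : ℕ} (h1 : 1 ≤ k) (h2 : k ≤ N + r) (ha : a ∈ seqT (r + 1) (N + r) k) :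
    1 ≤ a ∧ a ≤ N + r := by
  have hstart : ∀ {k a}, 1 ≤ k → k ≤ r + 2 → a ∈ seqT (r + 1) (N + r) k → 1 ≤ a ∧ a ≤ N + r := by
    intro k a h1 h2 ha
    rw [seqT_start (by omega) h1 h2, List.mem_append, List.mem_range'_1, List.mem_range'_1] at ha
    omega
  rcases Nat.lt_or_ge k (r + 3) with h | h
  · exact hstart h1 (by omega) ha
  rcases Nat.lt_or_ge (N - 2) k with h' | h'
  · have h3 := mirror_seqT hr hN hQ h1 h2
    have : reflect r N a ∈ seqT (r + 1) (N + r) (N + r + 1 - k) := by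
      rw [← h3, mirror]
      exact List.mem_map_of_mem (List.mem_reverse.2 ha)
    have := hstart (by omega) (by omega) this
    rw [reflect] at this
    split_ifs at this <;> omega
  · obtain ⟨j, rfl⟩ : ∃ j, k = r + 3 + j := ⟨k - (r + 3), by omega⟩
    rw [seqT_mid hr hN (by omega)] at ha
    exact mem_midBlock (by omega) ha

theorem length_prefixCat_start (hN : 3 ≤ N) {k : ℕ} (h2 : k ≤ r + 1) :
    (prefixCat (r + 1) (N + r) (k + 1)).length = N + r + k * (N + r - 1) := by
  induction k with
  | zero => rw [prefixCat_succ, List.length_append, length_seqT_start hN le_rfl (by omega)]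
            simp [prefixCat]
  | succ k ih =>
    rw [prefixCat_succ, List.length_append, length_seqT_start hN (by omega) (by omega),
      if_neg (by omega), ih (by omega)]
    ring

/-- The quotient `(j + r) / (2 * r + 1)` counts the `i < j` with `i ≡ r` modulo `2 * r + 1`, that is
the sequences without skip letters. -/
theorem length_prefixCat_mid (hr : 1 ≤ r) (hN : 3 * r + 5 ≤ N) {j : ℕ} (hj : r + 4 + j ≤ N) :
    (prefixCat (r + 1) (N + r) (r + 2 + j)).length + r * ((j + r) / (2 * r + 1))
      = N + r + (r + 1 + j) * (N + r - 1) := by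
  induction j with
  | zero =>
    rw [Nat.add_zero, length_prefixCat_start (by omega) le_rfl, Nat.zero_add,
      Nat.div_eq_of_lt (by omega)]
    ring
  | succ j ih =>
    have ih := ih (by omega)
    have ht := Nat.mod_lt j (show 2 * r + 1 > 0 by omega)
    have hdvd : 2 * r + 1 ∣ j + r + 1 ↔ j % (2 * r + 1) = r := by
      rw [Nat.dvd_iff_mod_eq_zero, Nat.add_assoc, Nat.add_mod_eq_ite,
        Nat.mod_eq_of_lt (show r + 1 < 2 * r + 1 by omega)]
      split_ifs
      · omega
      · exact iff_of_false id (by omega)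
    rw [← Nat.add_assoc, prefixCat_succ, List.length_append,
      show r + 2 + j + 1 = r + 3 + j by omega, seqT_mid hr hN (by omega),
      length_midBlock (by omega), show j + 1 + r = j + r + 1 by omega, Nat.succ_div,
      show r + 1 + (j + 1) = r + 1 + j + 1 by omega, Nat.add_mul (r + 1 + j), Nat.one_mul,
      Nat.mul_add]
    simp only [hdvd]
    split_ifs
    · rw [Nat.mul_one]; omega
    · rw [Nat.mul_zero]; omega

theorem length_prefixCat (hr : 1 ≤ r) (hN : 3 * r + 5 ≤ N)
    (hQ : N + r = 3 + (2 * r + 1) * Q) :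
    (prefixCat (r + 1) (N + r) (N + r)).length + r * (Q - 1)
      = (N + r) + (N + r - 2) * (N + r - 1) + (N + r) := by
  have hend : ∀ i ≤ r + 1, (prefixCat (r + 1) (N + r) (N - 2 + i)).length + r * (Q - 1)
      = N + r + (N - 3 + i) * (N + r - 1) := by
    intro i
    induction i with
    | zero =>
      intro _
      have hJ : N - (r + 4) = (2 * r + 1) * (Q - 1) := by rw [Nat.mul_sub]; omega
      have h := length_prefixCat_mid hr hN (j := N - (r + 4)) (by omega)
      rw [show r + 2 + (N - (r + 4)) = N - 2 by omega,
        show r + 1 + (N - (r + 4)) = N - 3 by omega, hJ,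
        Nat.mul_add_div (by omega), Nat.div_eq_of_lt (by omega), Nat.add_zero] at h
      exact h
    | succ i ih =>
      intro hi
      have ih := ih (by omega)
      rw [← Nat.add_assoc, prefixCat_succ, List.length_append,
        length_seqT_end hr hN hQ (by omega) (by omega), if_neg (by omega), ← Nat.add_assoc,
        Nat.add_mul _ 1, Nat.one_mul]
      omega
  have h := hend (r + 1) le_rfl
  rw [show N + r = (N - 2 + (r + 1)) + 1 by omega, prefixCat_succ, List.length_append,
    show N - 2 + (r + 1) + 1 = N + r by omega, length_seqT_end hr hN hQ (by omega) le_rfl,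
    if_pos rfl, show N + r - 2 = N - 3 + (r + 1) by omega]
  omega
end

/-! ### Interposing a letter, and change of alphabet -/

section
variable {α : Type*}

theorem flatten_concat_sublist_interpose (x : α) (L : List (List α)) :
    (L.flatten ++ [x]).Sublist (interpose x L) := by
  induction L with
  | nil => exact List.Sublist.refl _
  | cons σ L ih =>
    simp only [interpose, List.flatten_cons, List.flatMap_cons, List.append_assoc,
      List.singleton_append] at ih ⊢
    exact ((List.Sublist.refl σ).append ih).cons x

theorem flatten_sublist_flatMap (x : α) (L : List (List α)) :
    L.flatten.Sublist (L.flatMap (fun σ => σ ++ [x])) := by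
  induction L with
  | nil => exact List.Sublist.refl _
  | cons σ L ih =>
    rw [List.flatten_cons, List.flatMap_cons]
    exact (List.sublist_append_left _ _).append ih

theorem length_interpose (x : α) (L : List (List α)) :
    (interpose x L).length = L.flatten.length + L.length + 1 := by
  induction L with
  | nil => rfl
  | cons σ L ih =>
    simp only [interpose, List.flatMap_cons, List.length_cons, List.length_append,
      List.flatten_cons] at ih ⊢
    simp only [List.length_nil]
    omega

theorem IsSupersequence.transport {β : Type*} {A : Finset α} {B : Finset β} {w : List α}
    (h : IsSupersequence A w) {f : α → β} {g : β → α} (hf : ∀ a ∈ A, f a ∈ B)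
    (hg : ∀ b ∈ B, g b ∈ A) (hgf : ∀ a ∈ A, g (f a) = a) (hfg : ∀ b ∈ B, f (g b) = b) :
    IsSupersequence B (w.map f) := by
  refine ⟨fun b hb => ?_, fun ρ hρ hmem => ?_⟩
  · obtain ⟨a, ha, rfl⟩ := List.mem_map.1 hb
    exact hf a (h.1 a ha)
  · have h1 : (ρ.map g).Sublist w := by
      refine h.2 _ (List.Nodup.map_on (fun b hb c hc hbc => ?_) hρ) fun a => ?_
      · rw [← hfg b ((hmem b).1 hb), ← hfg c ((hmem c).1 hc), hbc]
      · rw [List.mem_map]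
        constructor
        · rintro ⟨b, hb, rfl⟩
          exact hg b ((hmem b).1 hb)
        · exact fun ha => ⟨f a, (hmem _).2 (hf a ha), hgf a ha⟩
    have h2 := h1.map f
    rw [List.map_map] at h2
    have h3 : ρ.map (f ∘ g) = ρ :=
      (List.map_congr_left fun b hb => hfg b ((hmem b).1 hb)).trans (List.map_id _)
    rwa [h3] at h2

theorem IsSupersequence.exists_of_card_eq {β : Type*} {A : Finset α} {w : List α}
    (h : IsSupersequence A w) (B : Finset β) (hcard : A.card = B.card) :
    ∃ v : List β, IsSupersequence B v ∧ v.length = w.length := by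
  classical
  rcases A.eq_empty_or_nonempty with rfl | ⟨a₀, ha₀⟩
  · have hw : w = [] := List.eq_nil_iff_forall_not_mem.2 fun a ha => by simpa using h.1 a ha
    refine ⟨[], ⟨by simp, fun ρ _ hρ => ?_⟩, by simp [hw]⟩
    have hB : B = ∅ := by rw [← Finset.card_eq_zero, ← hcard]; simp
    have : ρ = [] := List.eq_nil_iff_forall_not_mem.2 fun a ha => by simpa [hB] using (hρ a).1 ha
    simp [this]
  · let e : A ≃ B := Finset.equivOfCardEq hcard
    let b₀ : β := e ⟨a₀, ha₀⟩
    refine ⟨w.map fun a => if ha : a ∈ A then e ⟨a, ha⟩ else b₀,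
      h.transport (g := fun b => if hb : b ∈ B then e.symm ⟨b, hb⟩ else a₀) ?_ ?_ ?_ ?_, by simp⟩
    · intro a ha; simp [ha]
    · intro b hb; simp [hb]
    · intro a ha; simp [ha]
    · intro b hb; simp [hb]
end

/-! ### The supersequence -/

section
variable {r N Q : ℕ}

theorem isSupersequence_interpose (hr : 1 ≤ r) (hN : 3 * r + 5 ≤ N)
    (hQ : N + r = 3 + (2 * r + 1) * Q) {x : ℕ} (hx : x ∉ Finset.Icc 1 (N + r)) :
    IsSupersequence (insert x (Finset.Icc 1 (N + r)))
      (interpose x (listT (r + 1) (N + r))) := by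
  refine ⟨fun a ha => ?_, fun ρ hρ hmem => ?_⟩
  · rw [Finset.mem_insert, Finset.mem_Icc]
    simp only [interpose, listT, List.mem_cons, List.mem_flatMap, List.mem_map, List.mem_range,
      List.mem_append, List.not_mem_nil, or_false] at ha
    rcases ha with ha | ⟨_, ⟨i, hi, rfl⟩, ha | ha⟩
    · exact Or.inl ha
    · exact Or.inr (mem_seqT hr hN hQ (by omega) (by omega) ha)
    · exact Or.inl ha
  · obtain ⟨α, β, rfl⟩ := List.append_of_mem ((hmem x).2 (Finset.mem_insert_self _ _))
    have hcard : (α ++ x :: β).length = N + r + 1 := by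
      rw [← List.toFinset_card_of_nodup hρ,
        show (α ++ x :: β).toFinset = insert x (Finset.Icc 1 (N + r)) by
          ext a; rw [List.mem_toFinset, hmem],
        Finset.card_insert_of_notMem hx, Nat.card_Icc]
      omega
    rw [List.length_append, List.length_cons] at hcard
    rw [List.nodup_append, List.nodup_cons] at hρ
    obtain ⟨hα, ⟨hxβ, hβ⟩, hdisj⟩ := hρ
    have hα' : IsPartialPerm (N + r) α := ⟨hα, fun a ha => by
      have h := (hmem a).1 (by simp [ha])
      rw [Finset.mem_insert, Finset.mem_Icc] at h
      exact h.resolve_left (hdisj a ha x (by simp))⟩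
    have hβ' : IsPartialPerm (N + r) β := ⟨hβ, fun a ha => by
      have h := (hmem a).1 (by simp [ha])
      rw [Finset.mem_insert, Finset.mem_Icc] at h
      exact h.resolve_left (by rintro rfl; exact hxβ ha)⟩
    have h1 := sublist_prefixCat hr hN hQ hα' (by omega)
    rw [← flatten_take_listT (by omega)] at h1
    have h2 := sublist_drop_listT hr hN hQ hβ' (k := α.length) (by omega)
    have h3 := ((h1.append (List.Sublist.refl [x])).trans
      (flatten_concat_sublist_interpose x _)).append (h2.trans (flatten_sublist_flatMap x _))
    rw [interpose, List.cons_append, ← List.flatMap_append, List.take_append_drop,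
      List.append_assoc] at h3
    exact h3

theorem length_interpose_listT (hr : 1 ≤ r) (hN : 3 * r + 5 ≤ N)
    (hQ : N + r = 3 + (2 * r + 1) * Q) (x : ℕ) :
    (interpose x (listT (r + 1) (N + r))).length + r * (Q - 1) = (N + r) ^ 2 + 3 := by
  have h := length_prefixCat hr hN hQ
  have h2 : (listT (r + 1) (N + r)).flatten = prefixCat (r + 1) (N + r) (N + r) := rfl
  rw [length_interpose, h2]
  have h3 : (listT (r + 1) (N + r)).length = N + r := by simp [listT]
  rw [h3]
  generalize N + r = n at *
  obtain ⟨m, rfl⟩ : ∃ m, n = m + 2 := ⟨n - 2, by omega⟩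
  rw [Nat.add_sub_cancel, show m + 2 - 1 = m + 1 by omega] at h
  nlinarith
end

theorem theorem23 {α : Type*} (s n m : ℕ) (hs : 2 ≤ s) (hn : 4 * s + 1 ≤ n)
    (hmod : n ≡ 3 [MOD 2 * s - 1]) (hm : m = n + 1) :
    (∀ A : Finset α, A.card = m → ∃ w : List α, IsSupersequence A w ∧
      (w.length : ℤ) = ⌈(m : ℝ) ^ 2 - (5 * (s : ℝ) - 3) / (2 * (s : ℝ) - 1) * (m : ℝ)
        + (2 * (s : ℝ) ^ 2 + 9 * (s : ℝ) - 7) / (2 * (s : ℝ) - 1)⌉) ∧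
    (∀ x : ℕ, x ∉ Finset.Icc 1 n →
      IsSupersequence (insert x (Finset.Icc 1 n)) (interpose x (listT s n)) ∧
      ((interpose x (listT s n)).length : ℤ) =
        ⌈(m : ℝ) ^ 2 - (5 * (s : ℝ) - 3) / (2 * (s : ℝ) - 1) * (m : ℝ)
          + (2 * (s : ℝ) ^ 2 + 9 * (s : ℝ) - 7) / (2 * (s : ℝ) - 1)⌉) ∧
    (s = 2 → ⌈(m : ℝ) ^ 2 - (5 * (s : ℝ) - 3) / (2 * (s : ℝ) - 1) * (m : ℝ)
        + (2 * (s : ℝ) ^ 2 + 9 * (s : ℝ) - 7) / (2 * (s : ℝ) - 1)⌉ =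
      ⌈(m : ℝ) ^ 2 - 7 / 3 * (m : ℝ) + 19 / 3⌉) := by
  obtain ⟨r, rfl⟩ : ∃ r, s = r + 1 := ⟨s - 1, by omega⟩
  obtain ⟨N, rfl⟩ : ∃ N, n = N + r := ⟨n - r, by omega⟩
  have hr : 1 ≤ r := by omega
  have hN : 3 * r + 5 ≤ N := by omega
  obtain ⟨Q, hQ⟩ : ∃ Q, N + r = 3 + (2 * r + 1) * Q := by
    rw [show 2 * (r + 1) - 1 = 2 * r + 1 by omega] at hmod
    obtain ⟨Q, hQ⟩ := (Nat.modEq_iff_dvd' (show 3 ≤ N + r by omega)).1 hmod.symm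
    exact ⟨Q, by omega⟩
  have hQ1 : 1 ≤ Q := by
    rcases Nat.eq_zero_or_pos Q with rfl | h
    · omega
    · exact h
  have hlen : ∀ x, ((interpose x (listT (r + 1) (N + r))).length : ℤ) =
      ⌈(m : ℝ) ^ 2 - (5 * ((r + 1 : ℕ) : ℝ) - 3) / (2 * ((r + 1 : ℕ) : ℝ) - 1) * (m : ℝ)
        + (2 * ((r + 1 : ℕ) : ℝ) ^ 2 + 9 * ((r + 1 : ℕ) : ℝ) - 7)
          / (2 * ((r + 1 : ℕ) : ℝ) - 1)⌉ := by
    intro x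
    have h := length_interpose_listT hr hN hQ x
    have h' : ((interpose x (listT (r + 1) (N + r))).length : ℝ)
        = (m : ℝ) ^ 2 - (5 * ((r + 1 : ℕ) : ℝ) - 3) / (2 * ((r + 1 : ℕ) : ℝ) - 1) * (m : ℝ)
        + (2 * ((r + 1 : ℕ) : ℝ) ^ 2 + 9 * ((r + 1 : ℕ) : ℝ) - 7)
          / (2 * ((r + 1 : ℕ) : ℝ) - 1) := by
      have h1 : ((interpose x (listT (r + 1) (N + r))).length : ℝ) + r * (Q - 1)
          = ((N + r : ℕ) : ℝ) ^ 2 + 3 := by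
        have := congrArg (Nat.cast : ℕ → ℝ) h
        push_cast [Nat.cast_sub hQ1] at this ⊢
        exact this
      rw [hm, eq_sub_of_add_eq h1, hQ]
      have h2 : (2 * (r : ℝ) + 1) ≠ 0 := by positivity
      push_cast
      rw [show 2 * ((r : ℝ) + 1) - 1 = 2 * r + 1 by ring]
      field_simp
      ring
    rw [← h', Int.ceil_natCast]
  refine ⟨fun A hA => ?_, fun x hx => ⟨isSupersequence_interpose hr hN hQ hx, hlen x⟩, ?_⟩
  · have h0 : (0 : ℕ) ∉ Finset.Icc 1 (N + r) := by simp
    obtain ⟨w, hw, hwl⟩ := (isSupersequence_interpose hr hN hQ h0).exists_of_card_eq A (by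
      rw [Finset.card_insert_of_notMem h0, Nat.card_Icc, hA, hm]; omega)
    exact ⟨w, hw, by rw [hwl, hlen 0]⟩
  · intro h
    rw [h]
    norm_num
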